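/- Index sequences $x=(x_n)_n$ of complex numbers by the natural numbers, and let $e_n$ be the $n$-th canonical unit vector. For $1<q<\infty$ let $$\mathrm{ces}(q)=\{x\in\mathbb C^{\mathbb N}: C(|x|)\in\ell_q\},\quad \|x\|_{\mathrm{ces}(q)}=\|C(|x|)\|_{q},\qquad d(q)=\{x\in\ell_\infty:\hat x\in\ell_q\},\quad \|x\|_{d(q)}=\|\hat x\|_{q},$$ where $C(|x|)=\big(\tfrac{|x_1|+\dots+|x_n|}{n}\big)_n$ and $\hat x=(\sup_{k\ge n}|x_k|)_n$. Let $X\in\{\mathrm{ces},d\}$. For $1\le p<\infty$ let $X(p+)=\bigcap_{q>p}X(q)$, with the topology given by the norms $\|\cdot\|_{X(q)}$, $q>p$. For $1<p\le\infty$ let $X(p-)=\bigcup_{1<q<p}X(q)$, with the locally convex inductive limit topology, that is, the finest locally convex topology for which all inclusions $X(q)\to X(p-)$, $1<q<p$, are continuous. For a locally convex space $E$ let $E'$ be the space of continuous linear functionals on $E$ and let $E'_\beta$ be $E'$ with the strong topology (uniform convergence on the bounded sets of $E$); write $\langle x,f\rangle=f(x)$. A Fréchet–Schwartz space is a Fréchet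 space in which every neighbourhood $U$ of $0$ admits a neighbourhood $V$ of $0$ such that for every $\varepsilon>0$ the set $V$ is covered by finitely many translates of $\varepsilon U$. A (DFS)-space is a space topologically isomorphic to the strong dual of a Fréchet–Schwartz space. Let $p'$ denote the conjugate exponent, $\frac1p+\frac1{p'}=1$ (with $1'=\infty$ and $\infty'=1$). **Proposition 4.3.** (i) Let $1<p\le\infty$. The map $\Phi_p:(\mathrm{ces}(p'+))'\to d(p-)$, $\Phi_p(f)=(\langle e_n,f\rangle)_n$, is well defined, is a linear bijection, and is a topological isomorphism of the (DFS)-space $(\mathrm{ces}(p'+))'_\beta$ onto the (DFS)-space $d(p-)$. Moreover, $d(p-)=\mathrm{ind}_k\,d(p_k)$ (that is, $d(p-)=\bigcup_k d(p_k)$, with the locally convex inductive limit topology of the spaces $d(p_k)$) for every strictly increasing sequence $(p_k)_k\subseteq(1,p)$ with $p_k\to p$. (ii) Let $1\le p<\infty$. The map $\Psi_p:(\mathrm{ces}(p'-))'\to d(p+)$, $\Psi_p(g)=(\langle e_n,g\rangle)_n$, is well defined, is a linear bijection, and is a topological isomorphism of the Fréchet–Schwartz space $(\mathrm{ces}(p'-))'_\beta$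 onto the Fréchet–Schwartz space $d(p+)$. -/

import Mathlib

open Filter Topology
open scoped ENNReal

noncomputable section

namespace SeqSpace

/-! ### Functional-analytic notions -/

/-- The locally convex inductive limit topology on `E` for a family of linear maps `j i : F i → E`:
the finest locally convex vector space topology on `E` that makes every `j i` continuous
(in the order on topologies used by Mathlib, finer is smaller). -/
abbrev inductiveLimitTopology {ι E : Type*} [AddCommGroup E] [Module ℂ E] {F : ι → Type*}
    [∀ i, TopologicalSpace (F i)] (j : ∀ i, F i → E) : TopologicalSpace E :=
  sInf {t : TopologicalSpace E | @IsTopologicalAddGroup E t _ ∧ @ContinuousSMul ℂ E _ _ t ∧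
    @LocallyConvexSpace ℝ E _ _ _ _ t ∧ ∀ i, @Continuous (F i) E _ t (j i)}

/-- A Fréchet space over `ℂ`: a complete metrizable locally convex topological vector space. -/
structure IsFrechet (E : Type*) [AddCommGroup E] [Module ℂ E] [TopologicalSpace E] : Prop where
  topologicalAddGroup : IsTopologicalAddGroup E
  continuousSMul : ContinuousSMul ℂ E
  locallyConvex : LocallyConvexSpace ℝ E
  metrizable : TopologicalSpace.MetrizableSpace E
  complete : @CompleteSpace E (IsTopologicalAddGroup.rightUniformSpace E)

/-- A Fréchet-Schwartz space: a Fréchet space in which for every neighbourhood `U` of zero there is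
a neighbourhood `V` of zero such that for every `ε > 0` the set `V` is covered by finitely many
translates of `ε U`. -/
structure IsFrechetSchwartz (E : Type*) [AddCommGroup E] [Module ℂ E] [TopologicalSpace E] : Prop
    extends IsFrechet E where
  schwartz : ∀ U ∈ 𝓝 (0 : E), ∃ V ∈ 𝓝 (0 : E), ∀ ε : ℝ, 0 < ε →
    ∃ s : Finset E, ∀ v ∈ V, ∃ x ∈ s, ∃ u ∈ U, v = x + ε • u

/-- A (DFS)-space: a space topologically isomorphic to the strong dual of a Fréchet-Schwartz space.
(Mathlib's topology on `StrongDual ℂ F` is that of uniform convergence on bounded sets.) -/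
def IsDFS.{u} (E : Type u) [AddCommGroup E] [Module ℂ E] [TopologicalSpace E] : Prop :=
  ∃ (F : Type u) (_ : AddCommGroup F) (_ : Module ℂ F) (_ : TopologicalSpace F),
    IsFrechetSchwartz F ∧ Nonempty (E ≃L[ℂ] StrongDual ℂ F)

/-! ### Scales of normed sequence spaces and the spaces `X(p+)`, `X(p-)` built from them -/

/-- The exponents `1 < q < ∞`. -/
abbrev Exponent : Type := Set.Ioo (1 : ℝ≥0∞) ∞

instance (q : Exponent) : Fact (1 ≤ (q : ℝ≥0∞)) := ⟨q.2.1.le⟩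

/-- An increasing family `X(q)`, `1 < q < ∞`, of normed spaces of complex sequences that contain the
canonical vectors. The sequences are indexed by `ℕ = {0, 1, 2, …}`. -/
structure SequenceScale where
  space : Exponent → Submodule ℂ (ℕ → ℂ)
  norm : ∀ q, space q → ℝ
  norm_core : ∀ q, @NormedSpace.Core ℂ (space q) _ _ _ ⟨norm q⟩
  mono : Monotone space
  single_mem : ∀ q n, Pi.single n 1 ∈ space q

namespace SequenceScale

variable (S : SequenceScale)

/-- The normed space `X(q)`. It is a type of its own, so that it carries the topology of its norm and
not the topology of coordinatewise convergence. -/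
def Step (q : Exponent) : Type := S.space q

instance (q : Exponent) : AddCommGroup (S.Step q) := inferInstanceAs (AddCommGroup (S.space q))
instance (q : Exponent) : Module ℂ (S.Step q) := inferInstanceAs (Module ℂ (S.space q))
instance (q : Exponent) : Norm (S.Step q) := ⟨S.norm q⟩
instance (q : Exponent) : NormedAddCommGroup (S.Step q) :=
  NormedAddCommGroup.ofCore (𝕜 := ℂ) (E := S.Step q) (S.norm_core q)
instance (q : Exponent) : NormedSpace ℂ (S.Step q) where
  norm_smul_le c x :=
    (show NormedSpace.Core ℂ (S.Step q) from S.norm_core q).norm_smul c x |>.le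

/-- The linear space `X(p+) = ⋂_{q > p} X(q)`. -/
def plusSubmodule (p : ℝ≥0∞) : Submodule ℂ (ℕ → ℂ) where
  carrier := {x | ∀ q : Exponent, p < q → x ∈ S.space q}
  add_mem' hx hy q hq := (S.space q).add_mem (hx q hq) (hy q hq)
  zero_mem' q _ := (S.space q).zero_mem
  smul_mem' c _ hx q hq := (S.space q).smul_mem c (hx q hq)

/-- The space `X(p+)`, for `1 ≤ p < ∞`. -/
def Plus (p : ℝ≥0∞) : Type := S.plusSubmodule p

instance (p : ℝ≥0∞) : AddCommGroup (S.Plus p) := inferInstanceAs (AddCommGroup (S.plusSubmodule p))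
instance (p : ℝ≥0∞) : Module ℂ (S.Plus p) := inferInstanceAs (Module ℂ (S.plusSubmodule p))
instance (p : ℝ≥0∞) : CoeFun (S.Plus p) (fun _ => ℕ → ℂ) := ⟨fun x => x.1⟩

/-- The inclusion of `X(p+)` into `X(q)`, for `q > p`. -/
def plusToStep (p : ℝ≥0∞) (q : {q : Exponent // p < q}) (x : S.Plus p) : S.Step q :=
  ⟨x.1, x.2 q q.2⟩

/-- `X(p+)` carries the topology given by the norms of all `X(q)` with `q > p`. -/
instance (p : ℝ≥0∞) : TopologicalSpace (S.Plus p) :=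
  ⨅ q : {q : Exponent // p < q}, TopologicalSpace.induced (S.plusToStep p q) inferInstance

/-- The canonical vector `e_n` in `X(p+)`. -/
def ePlus (p : ℝ≥0∞) (n : ℕ) : S.Plus p := ⟨Pi.single n 1, fun q _ => S.single_mem q n⟩

/-- The linear space `X(p-) = ⋃_{1 < q < p} X(q)`, for `1 < p ≤ ∞`. -/
def minusSubmodule (p : ℝ≥0∞) (hp : 1 < p) : Submodule ℂ (ℕ → ℂ) where
  carrier := {x | ∃ q : Exponent, q < p ∧ x ∈ S.space q}
  add_mem' := by
    rintro x y ⟨q, hq, hx⟩ ⟨r, hr, hy⟩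
    rcases le_total q r with h | h
    · exact ⟨r, hr, (S.space r).add_mem (S.mono h hx) hy⟩
    · exact ⟨q, hq, (S.space q).add_mem hx (S.mono h hy)⟩
  zero_mem' := by
    obtain ⟨q, h1, h2⟩ := exists_between hp
    exact ⟨⟨q, h1, h2.trans_le le_top⟩, h2, Submodule.zero_mem _⟩
  smul_mem' := by
    rintro c x ⟨q, hq, hx⟩
    exact ⟨q, hq, (S.space q).smul_mem c hx⟩

/-- The space `X(p-)`, for `1 < p ≤ ∞`. -/
def Minus (p : ℝ≥0∞) (hp : 1 < p) : Type := S.minusSubmodule p hp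

variable (p : ℝ≥0∞) (hp : 1 < p)

instance : AddCommGroup (S.Minus p hp) := inferInstanceAs (AddCommGroup (S.minusSubmodule p hp))
instance : Module ℂ (S.Minus p hp) := inferInstanceAs (Module ℂ (S.minusSubmodule p hp))
instance : CoeFun (S.Minus p hp) (fun _ => ℕ → ℂ) := ⟨fun x => x.1⟩

/-- The inclusion of `X(q)` into `X(p-)`, for `1 < q < p`. -/
def stepToMinus (q : {q : Exponent // q < p}) (x : S.Step q) : S.Minus p hp :=
  ⟨x.1, q, q.2, x.2⟩

/-- `X(p-)` is the locally convex inductive limit of the spaces `X(q)` with `1 < q < p`. -/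
instance : TopologicalSpace (S.Minus p hp) := inductiveLimitTopology (S.stepToMinus p hp)

/-- The canonical vector `e_n` in `X(p-)`. -/
def eMinus (n : ℕ) : S.Minus p hp :=
  ⟨Pi.single n 1, by
    obtain ⟨q, h1, h2⟩ := exists_between hp
    exact ⟨⟨q, h1, h2.trans_le le_top⟩, h2, S.single_mem _ n⟩⟩

end SequenceScale

/-! ### The discrete Cesàro spaces and the spaces `d(q)` -/

/-- The Cesàro means `C(|x|)` of the moduli of a sequence. -/
def cesaroAbs (x : ℕ → ℂ) (n : ℕ) : ℝ := (∑ k ∈ Finset.range (n + 1), ‖x k‖) / (n + 1)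

/-- The sequence `x̂` with `x̂ n = sup_{k ≥ n} |x k|` (for bounded `x`). -/
def supTail (x : ℕ → ℂ) (n : ℕ) : ℝ := ⨆ k : ℕ, ‖x (n + k)‖

/-- The norm in `ℓ_q` of a real sequence that belongs to `ℓ_q`. -/
def lqNorm (q : ℝ≥0∞) (y : ℕ → ℝ) (hy : Memℓp y q) : ℝ := ‖(⟨y, hy⟩ : lp (fun _ : ℕ => ℝ) q)‖

section aux

variable (q : Exponent)

lemma exponent_ne_zero : (q : ℝ≥0∞) ≠ 0 := (zero_lt_one.trans q.2.1).ne'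

lemma lqNorm_le_add {a b c : ℕ → ℝ} (ha : Memℓp a q) (hb : Memℓp b q) (hc : Memℓp c q)
    (h0 : ∀ n, 0 ≤ c n) (h : ∀ n, c n ≤ a n + b n) :
    lqNorm q c hc ≤ lqNorm q a ha + lqNorm q b hb := by
  refine le_trans ?_ (norm_add_le (⟨a, ha⟩ : lp (fun _ : ℕ => ℝ) q) ⟨b, hb⟩)
  refine lp.norm_mono (exponent_ne_zero q) fun n => ?_
  change ‖c n‖ ≤ ‖a n + b n‖
  rw [Real.norm_of_nonneg (h0 n)]
  exact (h n).trans (le_abs_self _)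

lemma lqNorm_smul {a b : ℕ → ℝ} (t : ℝ) (ht : 0 ≤ t) (ha : Memℓp a q) (hb : Memℓp b q)
    (h : b = t • a) : lqNorm q b hb = t * lqNorm q a ha := by
  subst h
  have := lp.norm_const_smul (exponent_ne_zero q) (c := t) (⟨a, ha⟩ : lp (fun _ : ℕ => ℝ) q)
  rw [Real.norm_of_nonneg ht] at this
  exact this

lemma lqNorm_eq_zero {a : ℕ → ℝ} (ha : Memℓp a q) (h : lqNorm q a ha = 0) (n : ℕ) : a n = 0 := by
  have := lp.norm_apply_le_norm (exponent_ne_zero q) (⟨a, ha⟩ : lp (fun _ : ℕ => ℝ) q) n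
  change ‖a n‖ ≤ lqNorm q a ha at this
  rw [h] at this
  exact norm_le_zero_iff.1 this

lemma memlp_of_le {a c : ℕ → ℝ} (ha : Memℓp a q) (h0 : ∀ n, 0 ≤ c n) (h : ∀ n, c n ≤ a n) :
    Memℓp c q :=
  ha.mono fun n => by rw [Real.norm_of_nonneg (h0 n)]; exact h n

lemma cesaroAbs_nonneg (x : ℕ → ℂ) (n : ℕ) : 0 ≤ cesaroAbs x n := by
  unfold cesaroAbs; positivity

lemma cesaroAbs_add (x y : ℕ → ℂ) (n : ℕ) :
    cesaroAbs (x + y) n ≤ cesaroAbs x n + cesaroAbs y n := by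
  unfold cesaroAbs
  rw [← add_div, ← Finset.sum_add_distrib]
  gcongr
  exact norm_add_le _ _

lemma cesaroAbs_smul (c : ℂ) (x : ℕ → ℂ) : cesaroAbs (c • x) = ‖c‖ • cesaroAbs x := by
  funext n
  simp [cesaroAbs, ← Finset.mul_sum, mul_div_assoc]

lemma norm_le_cesaroAbs (x : ℕ → ℂ) (n : ℕ) : ‖x n‖ ≤ (n + 1) * cesaroAbs x n := by
  unfold cesaroAbs
  rw [mul_div_cancel₀ _ (by positivity)]
  exact Finset.single_le_sum (f := fun k => ‖x k‖) (fun _ _ => norm_nonneg _) (by simp)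

lemma memlp_cesaroAbs_single (n : ℕ) : Memℓp (cesaroAbs (Pi.single n 1)) q := by
  have hq : 1 < (q : ℝ≥0∞).toReal := by
    rw [← ENNReal.toReal_one]
    exact (ENNReal.toReal_lt_toReal ENNReal.one_ne_top q.2.2.ne).2 q.2.1
  have h1 : Memℓp (fun m : ℕ => 1 / ((m : ℝ) + 1)) q := by
    refine memℓp_gen ?_
    have := (summable_nat_add_iff 1).2 (Real.summable_one_div_nat_rpow.2 hq)
    refine this.congr fun m => ?_
    rw [Real.norm_of_nonneg (by positivity), Real.div_rpow (by positivity) (by positivity)]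
    simp
  refine memlp_of_le q h1 (cesaroAbs_nonneg _) fun m => ?_
  unfold cesaroAbs
  gcongr
  calc ∑ k ∈ Finset.range (m + 1), ‖(Pi.single n 1 : ℕ → ℂ) k‖
      = ∑ k ∈ Finset.range (m + 1), if k = n then (1 : ℝ) else 0 := by
        refine Finset.sum_congr rfl fun k _ => ?_
        by_cases h : k = n <;> simp [h]
    _ ≤ 1 := by rw [Finset.sum_ite_eq']; split_ifs <;> norm_num

variable {x y : ℕ → ℂ}

lemma bddAbove_tail (hx : Memℓp x ∞) (n : ℕ) : BddAbove (Set.range fun k => ‖x (n + k)‖) := by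
  refine (memℓp_infty_iff.1 hx).mono ?_
  rintro _ ⟨k, rfl⟩
  exact ⟨n + k, rfl⟩

lemma supTail_nonneg (x : ℕ → ℂ) (n : ℕ) : 0 ≤ supTail x n :=
  Real.iSup_nonneg fun _ => norm_nonneg _

lemma norm_le_supTail (hx : Memℓp x ∞) (n : ℕ) : ‖x n‖ ≤ supTail x n :=
  le_ciSup (bddAbove_tail hx n) 0

lemma supTail_add (hx : Memℓp x ∞) (hy : Memℓp y ∞) (n : ℕ) :
    supTail (x + y) n ≤ supTail x n + supTail y n :=
  ciSup_le fun k => (norm_add_le _ _).trans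
    (add_le_add (le_ciSup (bddAbove_tail hx n) k) (le_ciSup (bddAbove_tail hy n) k))

lemma supTail_smul (c : ℂ) (x : ℕ → ℂ) : supTail (c • x) = ‖c‖ • supTail x := by
  funext n
  simp [supTail, Real.mul_iSup_of_nonneg]

lemma memlp_infty_single (n : ℕ) : Memℓp (Pi.single n 1 : ℕ → ℂ) ∞ := by
  refine memℓp_infty ⟨1, ?_⟩
  rintro _ ⟨k, rfl⟩
  by_cases h : k = n <;> simp [h]

lemma memlp_supTail_single (n : ℕ) : Memℓp (supTail (Pi.single n 1)) q := by
  refine Memℓp.of_exponent_ge (p := q) (q := 0) (memℓp_zero ?_) bot_le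
  refine (Set.finite_Iic n).subset fun m hm => ?_
  by_contra hmn
  refine hm ?_
  have : ∀ k, ‖(Pi.single n 1 : ℕ → ℂ) (m + k)‖ = 0 := fun k => by
    have : m + k ≠ n := by simp only [Set.mem_Iic] at hmn; omega
    simp [this]
  simp [supTail, this]

end aux

/-- The linear space `ces(q) = {x : C(|x|) ∈ ℓ_q}`. -/
def cesSubmodule (q : Exponent) : Submodule ℂ (ℕ → ℂ) where
  carrier := {x | Memℓp (cesaroAbs x) q}
  add_mem' {x y} hx hy :=
    memlp_of_le q (Memℓp.add hx hy) (cesaroAbs_nonneg _) (cesaroAbs_add x y)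
  zero_mem' := by
    have : cesaroAbs 0 = 0 := by funext n; simp [cesaroAbs]
    simpa [this] using zero_memℓp
  smul_mem' c x hx := by
    change Memℓp (cesaroAbs (c • x)) q
    rw [cesaroAbs_smul]
    exact Memℓp.const_smul hx ‖c‖

/-- The linear space `d(q) = {x ∈ ℓ_∞ : x̂ ∈ ℓ_q}`. -/
def dSubmodule (q : Exponent) : Submodule ℂ (ℕ → ℂ) where
  carrier := {x | Memℓp x ∞ ∧ Memℓp (supTail x) q}
  add_mem' {x y} hx hy := ⟨hx.1.add hy.1,
    memlp_of_le q (Memℓp.add hx.2 hy.2) (supTail_nonneg _) (supTail_add hx.1 hy.1)⟩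
  zero_mem' := by
    have : supTail 0 = 0 := by funext n; simp [supTail]
    exact ⟨zero_memℓp, by rw [this]; exact zero_memℓp⟩
  smul_mem' c x hx := by
    refine ⟨Memℓp.const_smul hx.1 c, ?_⟩
    rw [supTail_smul]
    exact Memℓp.const_smul hx.2 ‖c‖

/-- The scale of discrete Cesàro spaces `ces(q) = {x : C(|x|) ∈ ℓ_q}` with the norms
`‖x‖ = ‖C(|x|)‖_q`. -/
def ces : SequenceScale where
  space := cesSubmodule
  norm q x := lqNorm q (cesaroAbs x.1) x.2
  norm_core q := by
    let : Norm (cesSubmodule q) := ⟨fun x => lqNorm q (cesaroAbs x.1) x.2⟩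
    exact
      { norm_nonneg := fun x => norm_nonneg (_ : lp (fun _ : ℕ => ℝ) q)
        norm_smul := fun c x => lqNorm_smul q ‖c‖ (norm_nonneg c) x.2 _ (cesaroAbs_smul c x.1)
        norm_triangle := fun x y =>
          lqNorm_le_add q x.2 y.2 _ (cesaroAbs_nonneg _) (cesaroAbs_add x.1 y.1)
        norm_eq_zero_iff := fun x => by
          refine ⟨fun h => Subtype.ext (funext fun n => norm_le_zero_iff.1 ?_), ?_⟩
          · have := norm_le_cesaroAbs x.1 n
            rwa [lqNorm_eq_zero q x.2 h n, mul_zero] at this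
          · rintro rfl
            have := lqNorm_smul q 0 le_rfl (0 : cesSubmodule q).2 (0 : cesSubmodule q).2
              (by funext n; simp [cesaroAbs])
            rwa [zero_mul] at this }
  mono q r h x hx := Memℓp.of_exponent_ge (f := cesaroAbs x) hx h
  single_mem q n := memlp_cesaroAbs_single q n

/-- The scale of spaces `d(q) = {x ∈ ℓ_∞ : x̂ ∈ ℓ_q}` with the norms `‖x‖ = ‖x̂‖_q`. -/
def d : SequenceScale where
  space := dSubmodule
  norm q x := lqNorm q (supTail x.1) x.2.2
  norm_core q := by
    let : Norm (dSubmodule q) := ⟨fun x => lqNorm q (supTail x.1) x.2.2⟩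
    exact
      { norm_nonneg := fun x => norm_nonneg (_ : lp (fun _ : ℕ => ℝ) q)
        norm_smul := fun c x => lqNorm_smul q ‖c‖ (norm_nonneg c) x.2.2 _ (supTail_smul c x.1)
        norm_triangle := fun x y =>
          lqNorm_le_add q x.2.2 y.2.2 _ (supTail_nonneg _) (supTail_add x.2.1 y.2.1)
        norm_eq_zero_iff := fun x => by
          refine ⟨fun h => Subtype.ext (funext fun n => norm_le_zero_iff.1 ?_), ?_⟩
          · have := norm_le_supTail x.2.1 n
            rwa [lqNorm_eq_zero q x.2.2 h n] at this
          · rintro rfl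
            have := lqNorm_smul q 0 le_rfl (0 : dSubmodule q).2.2 (0 : dSubmodule q).2.2
              (by funext n; simp [supTail])
            rwa [zero_mul] at this }
  mono q r h x hx := ⟨hx.1, Memℓp.of_exponent_ge (f := supTail x) hx.2 h⟩
  single_mem q n := ⟨memlp_infty_single n, memlp_supTail_single q n⟩

end SeqSpace

end

open SeqSpace

noncomputable section

namespace SeqSpace

/-! At the level of a single exponent, `ces(q)` and `d(q)` are awkward to dualize, but up to an
arbitrarily small loss in the exponent they are weighted `ℓ_1` and `ℓ_∞` spaces with power weights.
With weight `(n+1)^a`, `ces(q)` lies between the weighted `ℓ_1` spaces with `a` just below and just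
above `-1 + 1/q`, and `d(q)` between the weighted `ℓ_∞` spaces with `a` near `1/q`
(`isPowerScale_ces`, `isPowerScale_d`). Intersections over `q > p` and unions over `q < p` absorb
this loss, so everything can be done for an abstract `IsPowerScale`.

A strict gap between two exponents makes tails uniformly small (`WeightedBound.sub_trunc`). This
yields the convergence of `∑ x_n e_n` and the Schwartz property; completeness comes from a closed
embedding into a countable product of `ℓ_r`.

Weighted `ℓ_1` with exponent `a` is paired with weighted `ℓ_∞` with exponent `-a`, and the critical
exponents match since `-1 + 1/p' = -1/p`. So the coefficient maps are bijections with inverse `y ↦ ∑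
x_n y_n`. For the topologies, two directions are direct estimates on bounded sets. Continuity of `Φ`
is a bipolar argument: the polar of a neighbourhood of zero in `d(p-)` is bounded in `ces(p'+)`, and
Hahn–Banach recovers the seminorm from it. Continuity of `Ψ⁻¹` is Banach–Steinhaus in the Fréchet
space `d(p+)`. -/

/-! ### Power weights -/

/-- The weight `n ↦ (n + 1) ^ a`. -/
def weight (a : ℝ) (n : ℕ) : ℝ := ((n : ℝ) + 1) ^ a

lemma weight_pos (a : ℝ) (n : ℕ) : 0 < weight a n := by unfold weight; positivity

lemma weight_zero (n : ℕ) : weight 0 n = 1 := by simp [weight]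

lemma weight_one (n : ℕ) : weight 1 n = n + 1 := by simp [weight]

lemma weight_add (a b : ℝ) (n : ℕ) : weight (a + b) n = weight a n * weight b n :=
  Real.rpow_add (by positivity) a b

lemma weight_mul (a b : ℝ) (n : ℕ) : weight (a * b) n = weight a n ^ b :=
  Real.rpow_mul (by positivity) a b

lemma weight_neg_mul_self (a : ℝ) (n : ℕ) : weight (-a) n * weight a n = 1 := by
  rw [← weight_add, neg_add_cancel, weight_zero]

lemma weight_mul_neg_self (a : ℝ) (n : ℕ) : weight a n * weight (-a) n = 1 := by
  rw [mul_comm, weight_neg_mul_self]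

lemma weight_mono {a b : ℝ} (h : a ≤ b) (n : ℕ) : weight a n ≤ weight b n :=
  Real.rpow_le_rpow_of_exponent_le (by simp) h

lemma weight_anti {a : ℝ} (ha : a ≤ 0) {m n : ℕ} (h : m ≤ n) : weight a n ≤ weight a m :=
  Real.rpow_le_rpow_of_nonpos (by positivity) (by gcongr) ha

lemma tendsto_weight_neg {a : ℝ} (ha : a < 0) : Tendsto (weight a) atTop (𝓝 0) := by
  have h := (tendsto_rpow_neg_atTop (neg_pos.2 ha)).comp
    (tendsto_atTop_add_const_right atTop (1 : ℝ) tendsto_natCast_atTop_atTop)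
  simpa [Function.comp_def, weight] using! h

lemma summable_weight {a : ℝ} (ha : a < -1) : Summable (weight a) := by
  have h := (summable_nat_add_iff 1).2 (Real.summable_nat_rpow.2 ha)
  simpa [Function.comp_def, weight] using! h

/-- Multiplication of a sequence by `weight a`. -/
def wmul (a : ℝ) (x : ℕ → ℂ) (n : ℕ) : ℂ := (weight a n : ℂ) * x n

lemma norm_wmul (a : ℝ) (x : ℕ → ℂ) (n : ℕ) : ‖wmul a x n‖ = weight a n * ‖x n‖ := by
  rw [wmul, norm_mul, Complex.norm_real, Real.norm_of_nonneg (weight_pos a n).le]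

lemma wmul_add (a : ℝ) (x y : ℕ → ℂ) : wmul a (x + y) = wmul a x + wmul a y := by
  funext n; simp [wmul, mul_add]

lemma wmul_smul (a : ℝ) (c : ℂ) (x : ℕ → ℂ) : wmul a (c • x) = c • wmul a x := by
  funext n; simp [wmul, mul_left_comm]

/-- The sequence `weight a • x` lies in `ℓ_r` and has norm at most `M` there. -/
def WeightedBound (r : ℝ≥0∞) (a : ℝ) (x : ℕ → ℂ) (M : ℝ) : Prop :=
  ∃ h : Memℓp (wmul a x) r, ‖(⟨wmul a x, h⟩ : lp (fun _ : ℕ => ℂ) r)‖ ≤ M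

section WeightedBound

variable {r : ℝ≥0∞} {a b M : ℝ} {x y : ℕ → ℂ}

lemma WeightedBound.nonneg (h : WeightedBound r a x M) : 0 ≤ M := by
  obtain ⟨h, hM⟩ := h
  exact (lp.norm_nonneg' _).trans hM

lemma WeightedBound.mono_const {M' : ℝ} (h : WeightedBound r a x M) (hM : M ≤ M') :
    WeightedBound r a x M' := ⟨h.1, h.2.trans hM⟩

lemma WeightedBound.mono [Fact (1 ≤ r)] (h : WeightedBound r a x M)
    (hxy : ∀ n, weight b n * ‖y n‖ ≤ weight a n * ‖x n‖) : WeightedBound r b y M := by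
  have hle : ∀ n, ‖wmul b y n‖ ≤ ‖wmul a x n‖ := fun n => by
    rw [norm_wmul, norm_wmul]; exact hxy n
  have hr : r ≠ 0 := (zero_lt_one.trans_le (Fact.out : 1 ≤ r)).ne'
  cases h with
  | intro hx hM =>
    have hy : Memℓp (wmul b y) r := hx.mono' hle
    have := lp.norm_mono hr (x := (⟨_, hy⟩ : lp (fun _ : ℕ => ℂ) r))
      (y := (⟨_, hx⟩ : lp (fun _ : ℕ => ℂ) r)) hle
    exact ⟨hy, this.trans hM⟩

lemma WeightedBound.anti [Fact (1 ≤ r)] (h : WeightedBound r a x M) (hab : b ≤ a) :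
    WeightedBound r b x M :=
  h.mono fun n => mul_le_mul_of_nonneg_right (weight_mono hab n) (norm_nonneg _)

lemma WeightedBound.smul [Fact (1 ≤ r)] (h : WeightedBound r a x M) (c : ℂ) :
    WeightedBound r a (c • x) (‖c‖ * M) := by
  obtain ⟨h, hM⟩ := h
  refine ⟨by rw [wmul_smul]; exact h.const_smul c, ?_⟩
  have := norm_smul c (⟨wmul a x, h⟩ : lp (fun _ : ℕ => ℂ) r)
  calc _ = ‖c • (⟨wmul a x, h⟩ : lp (fun _ : ℕ => ℂ) r)‖ :=
        congrArg norm (Subtype.ext (wmul_smul a c x))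
    _ ≤ _ := by rw [this]; gcongr

lemma weightedBound_top : WeightedBound ∞ a x M ↔ ∀ n, weight a n * ‖x n‖ ≤ M := by
  constructor
  · rintro ⟨h, hM⟩ n
    rw [← norm_wmul]
    exact (lp.norm_apply_le_norm ENNReal.top_ne_zero
      (⟨wmul a x, h⟩ : lp (fun _ : ℕ => ℂ) ∞) n).trans hM
  · intro h
    refine ⟨memℓp_infty ⟨M, ?_⟩, lp.norm_le_of_forall_le' M fun n => ?_⟩
    · rintro _ ⟨n, rfl⟩
      simpa only [norm_wmul] using h n
    · simpa only [norm_wmul] using h n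

lemma weightedBound_one :
    WeightedBound 1 a x M ↔ ∀ N, ∑ n ∈ Finset.range N, weight a n * ‖x n‖ ≤ M := by
  constructor
  · rintro ⟨h, hM⟩ N
    have := lp.sum_rpow_le_norm_rpow (p := 1) (by simp)
      (⟨wmul a x, h⟩ : lp (fun _ : ℕ => ℂ) 1) (Finset.range N)
    simp only [ENNReal.toReal_one, Real.rpow_one, norm_wmul] at this
    exact this.trans hM
  · intro h
    have hs : ∀ s : Finset ℕ, ∑ n ∈ s, ‖wmul a x n‖ ^ (1 : ℝ≥0∞).toReal ≤
        M ^ (1 : ℝ≥0∞).toReal := fun s => by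
      simp only [ENNReal.toReal_one, Real.rpow_one, norm_wmul]
      refine le_trans (Finset.sum_le_sum_of_subset_of_nonneg (fun n hn => ?_)
        fun n _ _ => mul_nonneg (weight_pos a n).le (norm_nonneg _)) (h (s.sup id + 1))
      -- Any finite set of indices lies in an initial segment, so bounds on initial partial sums
      -- suffice.
      exact Finset.mem_range.2 (Nat.lt_succ_of_le (Finset.le_sup (f := id) hn))
    exact ⟨memℓp_gen' hs, lp.norm_le_of_forall_sum_le (by simp) (by simpa using h 0) hs⟩

end WeightedBound

/-! ### Comparison of `ces(q)` and `d(q)` with weighted spaces -/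

/-- The scale `S` lies between the weighted `ℓ_r`-spaces whose weights are powers with
exponents below and above `c + 1 / q`. -/
structure SequenceScale.IsPowerScale (S : SequenceScale) (r : ℝ≥0∞) (c : ℝ) : Prop where
  upper : ∀ (q : Exponent) (a : ℝ), a < c + ((q : ℝ≥0∞)⁻¹).toReal →
    ∃ C, 0 ≤ C ∧ ∀ x : S.Step q, WeightedBound r a x.1 (C * ‖x‖)
  lower : ∀ (q : Exponent) (a : ℝ), c + ((q : ℝ≥0∞)⁻¹).toReal < a →
    ∃ C, 0 ≤ C ∧ ∀ (x : ℕ → ℂ) (M : ℝ), WeightedBound r a x M →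
      ∃ h : x ∈ S.space q, S.norm q ⟨x, h⟩ ≤ C * M

section estimates

variable (q : Exponent)

lemma Exponent.one_lt_toReal : 1 < (q : ℝ≥0∞).toReal := by
  rw [← ENNReal.toReal_one]
  exact (ENNReal.toReal_lt_toReal ENNReal.one_ne_top q.2.2.ne).2 q.2.1

lemma Exponent.toReal_pos : 0 < (q : ℝ≥0∞).toReal := zero_lt_one.trans q.one_lt_toReal

lemma sum_rpow_le_lqNorm_rpow {y : ℕ → ℝ} (hy : Memℓp y q) (h0 : ∀ n, 0 ≤ y n) (s : Finset ℕ) :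
    ∑ n ∈ s, y n ^ (q : ℝ≥0∞).toReal ≤ lqNorm q y hy ^ (q : ℝ≥0∞).toReal := by
  have h := lp.sum_rpow_le_norm_rpow (q.toReal_pos) (⟨y, hy⟩ : lp (fun _ : ℕ => ℝ) q) s
  refine le_of_eq_of_le (Finset.sum_congr rfl fun n _ => ?_) h
  exact congrArg (· ^ (q : ℝ≥0∞).toReal) (Real.norm_of_nonneg (h0 n)).symm

lemma lqNorm_nonneg {y : ℕ → ℝ} (hy : Memℓp y q) : 0 ≤ lqNorm q y hy := norm_nonneg _

/-- The sequence `(n+1)^(-b)` is in `ℓ_q` because `b * q > 1`; its norm is the constant. The strict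
inequality is the loss of exponent in both comparisons. -/
lemma exists_lqNorm_le_of_decay {b : ℝ} (hb : ((q : ℝ≥0∞)⁻¹).toReal < b) :
    ∃ C, 0 ≤ C ∧ ∀ (y : ℕ → ℝ) (M : ℝ), 0 ≤ M → (∀ n, 0 ≤ y n) →
      (∀ n, y n ≤ M * weight (-b) n) → ∃ h : Memℓp y q, lqNorm q y h ≤ C * M := by
  have hw : Memℓp (weight (-b)) q := by
    refine memℓp_gen ?_
    have h1 : -b * (q : ℝ≥0∞).toReal < -1 := by
      rw [ENNReal.toReal_inv, inv_lt_iff_one_lt_mul₀ q.toReal_pos] at hb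
      linarith
    refine (summable_weight h1).congr fun n => ?_
    rw [Real.norm_of_nonneg (weight_pos _ _).le, weight_mul]
  refine ⟨lqNorm q _ hw, norm_nonneg _, fun y M hM h0 h => ?_⟩
  have hMw : Memℓp (M • weight (-b)) q := hw.const_smul M
  refine ⟨memlp_of_le q hMw h0 h, ?_⟩
  rw [mul_comm, ← lqNorm_smul q M hM hw hMw rfl]
  refine lp.norm_mono (exponent_ne_zero q) fun n => ?_
  change ‖y n‖ ≤ ‖M * weight (-b) n‖
  rw [Real.norm_of_nonneg (h0 n)]
  exact (h n).trans (le_abs_self _)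

/-- Since `x̂` is decreasing, each of the first `n + 1` terms of `∑ x̂_m ^ q` is at least `x̂_n ^
q`. -/
lemma weight_mul_supTail_le {x : ℕ → ℂ} (hx : Memℓp x ∞) (hs : Memℓp (supTail x) q) (n : ℕ) :
    weight ((q : ℝ≥0∞)⁻¹).toReal n * supTail x n ≤ lqNorm q _ hs := by
  have hq := q.toReal_pos
  refine (Real.rpow_le_rpow_iff (mul_nonneg (weight_pos _ _).le (supTail_nonneg x n))
    (lqNorm_nonneg q hs) hq).1 ?_
  refine le_trans ?_ (sum_rpow_le_lqNorm_rpow q hs (supTail_nonneg x) (Finset.range (n + 1)))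
  rw [Real.mul_rpow (weight_pos _ _).le (supTail_nonneg x n), ← weight_mul, ENNReal.toReal_inv,
    inv_mul_cancel₀ hq.ne', weight_one]
  have : ∀ m ∈ Finset.range (n + 1),
      supTail x n ^ (q : ℝ≥0∞).toReal ≤ supTail x m ^ (q : ℝ≥0∞).toReal := fun m hm => by
    refine Real.rpow_le_rpow (supTail_nonneg x n) (ciSup_le fun k => ?_) hq.le
    have := le_ciSup (bddAbove_tail hx m) (n - m + k)
    have hmn : m + (n - m + k) = n + k := by rw [Finset.mem_range] at hm; omega
    rwa [hmn] at this
  simpa using Finset.card_nsmul_le_sum _ _ _ this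

/-- Upper bound: monotonicity of `x̂`. Lower bound: a decreasing majorant of `|x|` also majorizes
`x̂`, and a power with exponent below `-1/q` is in `ℓ_q`. -/
theorem isPowerScale_d : d.IsPowerScale ∞ 0 where
  upper q a ha := by
    refine ⟨1, zero_le_one, fun x => weightedBound_top.2 fun n => ?_⟩
    rw [zero_add] at ha
    rw [one_mul]
    exact (mul_le_mul (weight_mono ha.le n) (norm_le_supTail x.2.1 n) (norm_nonneg _)
      (weight_pos _ _).le).trans (weight_mul_supTail_le q x.2.1 x.2.2 n)
  lower q b hb := by
    rw [zero_add] at hb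
    obtain ⟨C, hC, h⟩ := exists_lqNorm_le_of_decay q hb
    refine ⟨C, hC, fun x M hx => ?_⟩
    have hM := hx.nonneg
    have hb0 : -b ≤ 0 := neg_nonpos.2 (ENNReal.toReal_nonneg.trans hb.le)
    have hx' : ∀ n, ‖x n‖ ≤ M * weight (-b) n := fun n => by
      have := mul_le_mul_of_nonneg_right (weightedBound_top.1 hx n) (weight_pos (-b) n).le
      rwa [mul_right_comm, weight_mul_neg_self, one_mul] at this
    obtain ⟨h1, h2⟩ := h (supTail x) M hM (supTail_nonneg x) fun n => ciSup_le fun k =>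
      (hx' _).trans (mul_le_mul_of_nonneg_left (weight_anti hb0 (Nat.le_add_right n k)) hM)
    refine ⟨⟨memℓp_infty ⟨M, ?_⟩, h1⟩, h2⟩
    rintro _ ⟨n, rfl⟩
    refine (hx' n).trans (mul_le_of_le_one_right hM ?_)
    simpa [weight] using weight_anti hb0 (Nat.zero_le n)

/-- Up to the factor `2^(1-a)`, `(k+1)^a` is at most the sum of `(n+1)^(a-1)` over the dyadic block
`k ≤ n ≤ 2k`. Exchanging the two sums turns the inner one into `∑_{k ≤ n} |x_k|`, that is, `n + 1`
times a Cesàro mean. -/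
lemma sum_weight_mul_le_cesaroAbs {a : ℝ} (ha : a ≤ 1) (x : ℕ → ℂ) (N : ℕ) :
    ∑ k ∈ Finset.range N, weight a k * ‖x k‖ ≤
      (2 : ℝ) ^ (1 - a) * ∑ n ∈ Finset.range (2 * N), weight a n * cesaroAbs x n := by
  have hw : ∀ k, weight a k ≤
      (2 : ℝ) ^ (1 - a) * ∑ n ∈ Finset.Icc k (2 * k), weight (a - 1) n := fun k => by
    have h1 : ∀ n ∈ Finset.Icc k (2 * k), (2 : ℝ) ^ (a - 1) * weight (a - 1) k ≤
        weight (a - 1) n := fun n hn => by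
      unfold weight
      rw [← Real.mul_rpow (by norm_num) (by positivity)]
      -- Here `n + 1 ≤ 2 (k + 1)` and the exponent `a - 1` is nonpositive.
      refine Real.rpow_le_rpow_of_nonpos (by positivity) ?_ (by linarith)
      have : (n : ℝ) ≤ 2 * k := by exact_mod_cast (Finset.mem_Icc.1 hn).2
      linarith
    have h2 := Finset.card_nsmul_le_sum _ _ _ h1
    have hcard : (Finset.Icc k (2 * k)).card = k + 1 := by rw [Nat.card_Icc]; omega
    rw [hcard, nsmul_eq_mul, Nat.cast_add_one] at h2
    calc weight a k = (2 : ℝ) ^ (1 - a) *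
          ((k + 1) * ((2 : ℝ) ^ (a - 1) * weight (a - 1) k)) := by
          rw [← weight_one, mul_left_comm (weight 1 k), ← weight_add, ← mul_assoc,
            ← Real.rpow_add two_pos]
          simp
      _ ≤ _ := by gcongr
  calc ∑ k ∈ Finset.range N, weight a k * ‖x k‖
      ≤ ∑ k ∈ Finset.range N, ((2 : ℝ) ^ (1 - a) *
          ∑ n ∈ Finset.Icc k (2 * k), weight (a - 1) n) * ‖x k‖ := by
        gcongr with k; exact hw k
    _ = (2 : ℝ) ^ (1 - a) *
          ∑ k ∈ Finset.range N, ∑ n ∈ Finset.Icc k (2 * k), weight (a - 1) n * ‖x k‖ := by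
        rw [Finset.mul_sum]
        refine Finset.sum_congr rfl fun k _ => ?_
        rw [mul_assoc, Finset.sum_mul]
    _ ≤ (2 : ℝ) ^ (1 - a) * ∑ n ∈ Finset.range (2 * N),
          ∑ k ∈ Finset.range (n + 1), weight (a - 1) n * ‖x k‖ := by
        gcongr
        rw [Finset.sum_sigma', Finset.sum_sigma',
          ← Finset.sum_image (s := (Finset.range N).sigma fun k => Finset.Icc k (2 * k))
            (g := fun z : (_ : ℕ) × ℕ => (⟨z.2, z.1⟩ : (_ : ℕ) × ℕ))
            (f := fun z : (_ : ℕ) × ℕ => weight (a - 1) z.1 * ‖x z.2‖)]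
        · refine Finset.sum_le_sum_of_subset_of_nonneg ?_ fun z _ _ =>
            mul_nonneg (weight_pos _ _).le (norm_nonneg _)
          intro z hz
          simp only [Finset.mem_image, Finset.mem_sigma, Finset.mem_range, Finset.mem_Icc] at hz ⊢
          obtain ⟨w, hw, rfl⟩ := hz
          dsimp only
          omega
        · rintro ⟨_, _⟩ _ ⟨_, _⟩ _ h
          simp_all
    _ = _ := by
        congr 1
        refine Finset.sum_congr rfl fun n _ => ?_
        rw [← Finset.mul_sum, cesaroAbs, weight, Real.rpow_sub_one (by positivity), weight]
        ring

/-- Upper bound: Hölder applied to `∑ (n+1)^a C(|x|)_n`, where `(n+1)^a` lies in `ℓ_s` for the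
conjugate exponent `s` of `q` because `a < -1/s = -1 + 1/q`. Lower bound: a decreasing weight gives
`(n+1)^a ∑_{k ≤ n} |x_k| ≤ M`, hence `C(|x|)_n ≤ M (n+1)^(-(1+a))` with `1 + a > 1/q`. -/
theorem isPowerScale_ces : ces.IsPowerScale 1 (-1) where
  upper q a ha := by
    have hq := q.one_lt_toReal
    have hpq : (q : ℝ≥0∞).toReal.HolderConjugate (q : ℝ≥0∞).toReal.conjExponent :=
      Real.HolderConjugate.conjExponent hq
    set s := (q : ℝ≥0∞).toReal.conjExponent
    rw [ENNReal.toReal_inv] at ha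
    have ha' : a * s < -1 := by
      have h1 := hpq.inv_add_inv_eq_one
      have h2 : a < -s⁻¹ := by linarith
      have h3 := mul_lt_mul_of_pos_right h2 hpq.symm.pos
      rwa [neg_mul, inv_mul_cancel₀ hpq.symm.ne_zero] at h3
    have ha1 : a ≤ 1 := by have := inv_le_one_of_one_le₀ hq.le; linarith
    refine ⟨2 ^ (1 - a) * (∑' n, weight (a * s) n) ^ (1 / s), mul_nonneg (by positivity)
      (Real.rpow_nonneg (tsum_nonneg fun n => (weight_pos _ _).le) _),
      fun x => weightedBound_one.2 fun N => ?_⟩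
    refine (sum_weight_mul_le_cesaroAbs ha1 x.1 N).trans ?_
    rw [mul_assoc]
    gcongr
    have hH := Real.inner_le_Lp_mul_Lq_of_nonneg (Finset.range (2 * N)) hpq.symm
      (f := weight a) (g := cesaroAbs x.1) (fun n _ => (weight_pos a n).le)
      (fun n _ => cesaroAbs_nonneg _ n)
    refine hH.trans ?_
    have h1 : ∑ n ∈ Finset.range (2 * N), weight a n ^ s ≤ ∑' n, weight (a * s) n := by
      simp_rw [← weight_mul]
      exact (summable_weight ha').sum_le_tsum _ fun n _ => (weight_pos _ _).le
    have h2 : (∑ n ∈ Finset.range (2 * N), cesaroAbs x.1 n ^ (q : ℝ≥0∞).toReal) ^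
        (1 / (q : ℝ≥0∞).toReal) ≤ ‖x‖ := by
      rw [one_div, Real.rpow_inv_le_iff_of_pos (Finset.sum_nonneg fun n _ =>
        Real.rpow_nonneg (cesaroAbs_nonneg _ _) _) (norm_nonneg x) q.toReal_pos]
      exact sum_rpow_le_lqNorm_rpow q x.2 (cesaroAbs_nonneg _) _
    have h3 : 0 ≤ ∑ n ∈ Finset.range (2 * N), weight a n ^ s :=
      Finset.sum_nonneg fun n _ => Real.rpow_nonneg (weight_pos _ _).le _
    have h4 : 0 ≤ 1 / s := by have := hpq.symm.pos; positivity
    exact mul_le_mul (Real.rpow_le_rpow h3 h1 h4) h2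
      (Real.rpow_nonneg (Finset.sum_nonneg fun n _ => Real.rpow_nonneg (cesaroAbs_nonneg _ _) _) _)
      (Real.rpow_nonneg (h3.trans h1) _)
  lower q a' ha' := by
    have hq := inv_lt_one_of_one_lt₀ q.one_lt_toReal
    rw [← ENNReal.toReal_inv] at hq
    -- The exponent may be lowered to a nonpositive one, since the critical exponent `-1 + 1/q` is
    -- negative; the weight is then decreasing.
    obtain ⟨a, ha, haa, ha0⟩ : ∃ a, -1 + ((q : ℝ≥0∞)⁻¹).toReal < a ∧ a ≤ a' ∧ a ≤ 0 :=
      ⟨min a' 0, lt_min ha' (by linarith), min_le_left _ _, min_le_right _ _⟩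
    obtain ⟨C, hC, h⟩ := exists_lqNorm_le_of_decay q (b := 1 + a) (by linarith)
    refine ⟨C, hC, fun x M hx => ?_⟩
    refine h (cesaroAbs x) M hx.nonneg (cesaroAbs_nonneg x) fun n => ?_
    have h1 := weightedBound_one.1 (hx.anti haa) (n + 1)
    have h2 : weight a n * ∑ k ∈ Finset.range (n + 1), ‖x k‖ ≤ M := by
      refine le_trans ?_ h1
      rw [Finset.mul_sum]
      gcongr with k hk
      exact weight_anti ha0 (Nat.lt_succ_iff.1 (Finset.mem_range.1 hk))
    have h3 : weight a n * (weight 1 n * cesaroAbs x n) ≤ M := by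
      rwa [weight_one, cesaroAbs, mul_div_cancel₀ _ (by positivity)]
    calc cesaroAbs x n
        = weight a n * (weight 1 n * cesaroAbs x n) * weight (-(1 + a)) n := by
          have h4 := weight_mul_neg_self (1 + a) n
          rw [weight_add] at h4
          linear_combination -cesaroAbs x n * h4
      _ ≤ _ := mul_le_mul_of_nonneg_right h3 (weight_pos _ _).le

end estimates

/-! ### Truncations -/

/-- The truncation of a sequence to its first `N` coordinates. -/
def trunc (N : ℕ) (x : ℕ → ℂ) : ℕ → ℂ := ∑ n ∈ Finset.range N, x n • Pi.single n 1

lemma trunc_apply (N : ℕ) (x : ℕ → ℂ) (m : ℕ) : trunc N x m = if m < N then x m else 0 := by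
  simp only [trunc, Finset.sum_apply, Pi.smul_apply, smul_eq_mul, Pi.single_apply, mul_ite,
    mul_one, mul_zero]
  simp

section WeightedBound

variable {r : ℝ≥0∞} {a b M : ℝ} {x y : ℕ → ℂ} [Fact (1 ≤ r)]

lemma WeightedBound.add {M' : ℝ} (hx : WeightedBound r a x M) (hy : WeightedBound r a y M') :
    WeightedBound r a (x + y) (M + M') := by
  cases hx with
  | intro hx hM =>
  cases hy with
  | intro hy hM' =>
    have h := norm_add_le (⟨_, hx⟩ : lp (fun _ : ℕ => ℂ) r) ⟨_, hy⟩
    have hxy : Memℓp (wmul a (x + y)) r := by rw [wmul_add]; exact hx.add hy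
    refine ⟨hxy, ?_⟩
    have he : (⟨_, hxy⟩ : lp (fun _ : ℕ => ℂ) r) = ⟨_, hx⟩ + ⟨_, hy⟩ :=
      Subtype.ext (wmul_add a x y)
    rw [he]
    exact h.trans (add_le_add hM hM')

lemma WeightedBound.coord_le (h : WeightedBound r a x M) (n : ℕ) : weight a n * ‖x n‖ ≤ M := by
  have hr : r ≠ 0 := (zero_lt_one.trans_le (Fact.out : 1 ≤ r)).ne'
  cases h with
  | intro hx hM =>
    rw [← norm_wmul]
    exact (lp.norm_apply_le_norm hr (⟨_, hx⟩ : lp (fun _ : ℕ => ℂ) r) n).trans hM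

/-- From index `N` on, the ratio `(n+1)^(b-a)` of the two weights is at most its value at `N`. For
`b < a` this makes tails small uniformly on balls, the source of all convergence and compactness
below. -/
lemma WeightedBound.sub_trunc (h : WeightedBound r a x M) (hba : b ≤ a) (N : ℕ) :
    WeightedBound r b (x - trunc N x) (weight (b - a) N * M) := by
  have h' := h.smul (weight (b - a) N : ℂ)
  rw [Complex.norm_real, Real.norm_of_nonneg (weight_pos _ _).le] at h'
  refine h'.mono fun n => ?_
  rw [Pi.smul_apply, norm_smul, Complex.norm_real, Real.norm_of_nonneg (weight_pos _ _).le,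
    Pi.sub_apply, trunc_apply]
  split_ifs with hn
  · rw [sub_self, norm_zero, mul_zero]
    exact mul_nonneg (weight_pos _ _).le (mul_nonneg (weight_pos _ _).le (norm_nonneg _))
  · rw [sub_zero, ← mul_assoc]
    refine mul_le_mul_of_nonneg_right ?_ (norm_nonneg _)
    have hb : weight b n = weight a n * weight (b - a) n := by rw [← weight_add]; congr 1; ring
    rw [hb]
    exact mul_le_mul_of_nonneg_left (weight_anti (by linarith) (not_lt.1 hn)) (weight_pos _ _).le

end WeightedBound

lemma eventually_weight_mul_lt {a : ℝ} (ha : a < 0) (M : ℝ) {ε : ℝ} (hε : 0 < ε) :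
    ∀ᶠ N in atTop, weight a N * M < ε := by
  have h := (tendsto_weight_neg ha).mul_const M
  rw [zero_mul] at h
  exact h.eventually (gt_mem_nhds hε)

/-! ### Exponents -/

lemma toReal_inv_lt_toReal_inv {p q : ℝ≥0∞} (hp : p ≠ 0) (h : p < q) :
    (q⁻¹).toReal < (p⁻¹).toReal :=
  (ENNReal.toReal_lt_toReal (ENNReal.inv_ne_top.2 (bot_le.trans_lt h).ne')
    (ENNReal.inv_ne_top.2 hp)).2 (ENNReal.inv_lt_inv.2 h)

lemma lt_of_toReal_inv_lt_toReal_inv {p q : ℝ≥0∞} (hp : p ≠ 0) (hq : q ≠ 0)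
    (h : (q⁻¹).toReal < (p⁻¹).toReal) : p < q :=
  ENNReal.inv_lt_inv.1 ((ENNReal.toReal_lt_toReal (ENNReal.inv_ne_top.2 hq)
    (ENNReal.inv_ne_top.2 hp)).1 h)

lemma exists_exponent_toReal_inv_eq {t : ℝ} (h0 : 0 < t) (h1 : t < 1) :
    ∃ q : Exponent, ((q : ℝ≥0∞)⁻¹).toReal = t := by
  have ht : 0 < ENNReal.ofReal t := ENNReal.ofReal_pos.2 h0
  refine ⟨⟨(ENNReal.ofReal t)⁻¹, ENNReal.one_lt_inv.2 ?_, ENNReal.inv_lt_top.2 ht⟩, ?_⟩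
  · rw [← ENNReal.ofReal_one]; exact (ENNReal.ofReal_lt_ofReal_iff one_pos).2 h1
  · simp [h0.le]

lemma exists_exponent_gt {p : ℝ≥0∞} (hp1 : 1 ≤ p) (hp : p < ∞) {s : ℝ} (hs : s < (p⁻¹).toReal) :
    ∃ q : Exponent, p < q ∧ s < ((q : ℝ≥0∞)⁻¹).toReal := by
  have hp0 : p ≠ 0 := (zero_lt_one.trans_le hp1).ne'
  have ht : 0 < (p⁻¹).toReal :=
    ENNReal.toReal_pos (ENNReal.inv_ne_zero.2 hp.ne) (ENNReal.inv_ne_top.2 hp0)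
  have ht1 : (p⁻¹).toReal ≤ 1 := by
    rw [← ENNReal.toReal_one]
    exact ENNReal.toReal_mono ENNReal.one_ne_top (ENNReal.inv_le_one.2 hp1)
  -- The reciprocal `t` of the exponent must be positive to have `q < ∞`, hence the maximum with
  -- zero.
  obtain ⟨t, h1, h2⟩ := exists_between (max_lt hs ht)
  obtain ⟨q, hq⟩ := exists_exponent_toReal_inv_eq (t := t) ((le_max_right _ _).trans_lt h1)
    (h2.trans_le ht1)
  refine ⟨q, lt_of_toReal_inv_lt_toReal_inv hp0 (exponent_ne_zero q) (hq ▸ h2), ?_⟩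
  rw [hq]
  exact (le_max_left _ _).trans_lt h1

lemma exists_exponent_lt {p : ℝ≥0∞} (hp1 : 1 < p) {s : ℝ} (hs : (p⁻¹).toReal < s) :
    ∃ q : Exponent, q < p ∧ ((q : ℝ≥0∞)⁻¹).toReal < s := by
  have hp0 : p ≠ 0 := (zero_lt_one.trans hp1).ne'
  have ht1 : (p⁻¹).toReal < 1 := by
    simpa using toReal_inv_lt_toReal_inv one_ne_zero hp1
  obtain ⟨t, h1, h2⟩ := exists_between (lt_min hs ht1)
  obtain ⟨q, hq⟩ := exists_exponent_toReal_inv_eq (t := t) (ENNReal.toReal_nonneg.trans_lt h1)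
    (h2.trans_le (min_le_right _ _))
  refine ⟨q, lt_of_toReal_inv_lt_toReal_inv (exponent_ne_zero q) hp0 (hq ▸ h1), ?_⟩
  rw [hq]
  exact h2.trans_le (min_le_left _ _)

/-! ### Fréchet spaces -/

/-- A homomorphism that induces the topology also induces the uniformity, so the completeness of its
closed range passes back to `E`. -/
lemma IsFrechet.of_isClosedEmbedding {E F : Type*} [AddCommGroup E] [Module ℂ E]
    [TopologicalSpace E] [hE : IsTopologicalAddGroup E] [ContinuousSMul ℂ E]
    [LocallyConvexSpace ℝ E] [AddCommGroup F] [UniformSpace F] [IsUniformAddGroup F]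
    [TopologicalSpace.MetrizableSpace F] [CompleteSpace F] (f : E →+ F)
    (hf : IsClosedEmbedding f) : IsFrechet E := by
  refine ⟨hE, inferInstance, inferInstance, hf.isEmbedding.metrizableSpace, ?_⟩
  let : UniformSpace E := IsTopologicalAddGroup.rightUniformSpace E
  have : IsUniformAddGroup E := isUniformAddGroup_of_addCommGroup
  have hu : IsUniformInducing f := AddMonoidHom.isUniformInducing_of_isInducing hf.isInducing
  exact hu.completeSpace hf.isClosed_range.isComplete

lemma IsFrechetSchwartz.of_continuousLinearEquiv {E F : Type*} [AddCommGroup E] [Module ℂ E]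
    [TopologicalSpace E] [IsTopologicalAddGroup E] [ContinuousSMul ℂ E] [LocallyConvexSpace ℝ E]
    [AddCommGroup F] [Module ℂ F] [TopologicalSpace F]
    (hF : IsFrechetSchwartz F) (e : E ≃L[ℂ] F) : IsFrechetSchwartz E where
  toIsFrechet := by
    have := hF.topologicalAddGroup
    have := hF.metrizable
    let : UniformSpace F := IsTopologicalAddGroup.rightUniformSpace F
    have : IsUniformAddGroup F := isUniformAddGroup_of_addCommGroup
    have : CompleteSpace F := hF.complete
    exact .of_isClosedEmbedding (e : E →+ F) e.toHomeomorph.isClosedEmbedding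
  schwartz U hU := by
    classical
    obtain ⟨V, hV, h⟩ := hF.schwartz (e.symm ⁻¹' U)
      (e.symm.continuous.continuousAt.preimage_mem_nhds (by rwa [map_zero]))
    refine ⟨e ⁻¹' V, e.continuous.continuousAt.preimage_mem_nhds (by rwa [map_zero]),
      fun ε hε => ?_⟩
    obtain ⟨s, hs⟩ := h ε hε
    refine ⟨s.image e.symm, fun v hv => ?_⟩
    obtain ⟨x, hx, u, hu, huv⟩ := hs _ hv
    refine ⟨e.symm x, Finset.mem_image_of_mem _ hx, e.symm u, hu, ?_⟩
    apply e.injective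
    have : e (ε • e.symm u) = ε • u := by
      rw [← Complex.coe_smul, map_smul, e.apply_symm_apply, Complex.coe_smul]
    rw [huv, map_add, this, e.apply_symm_apply]

namespace SequenceScale

variable {S : SequenceScale} {r : ℝ≥0∞} {c : ℝ}

/-! ### The spaces `X(p+)` -/

section Plus

variable {p : ℝ≥0∞}

variable (S p) in
/-- The inclusion of `X(p+)` into `X(q)`, as a linear map. -/
def plusToStepₗ (q : {q : Exponent // p < q}) : S.Plus p →ₗ[ℂ] S.Step q where
  toFun := S.plusToStep p q
  map_add' _ _ := rfl
  map_smul' _ _ := rfl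

variable (S p) in
/-- The inclusion of `X(p+)` into the space of all sequences. -/
def plusCoe : S.Plus p →ₗ[ℂ] ℕ → ℂ := (S.plusSubmodule p).subtype

instance : IsTopologicalAddGroup (S.Plus p) :=
  topologicalAddGroup_iInf fun q => topologicalAddGroup_induced (S.plusToStepₗ p q)

instance : ContinuousSMul ℂ (S.Plus p) :=
  continuousSMul_iInf fun q => continuousSMul_induced (S.plusToStepₗ p q)

instance : LocallyConvexSpace ℝ (S.Plus p) :=
  .iInf fun q => .induced ((S.plusToStepₗ p q).restrictScalars ℝ)

lemma continuous_plusToStep (q : {q : Exponent // p < q}) : Continuous (S.plusToStep p q) :=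
  continuous_iInf_dom continuous_induced_dom

lemma plusCoe_sum_ePlus (N : ℕ) (x : ℕ → ℂ) :
    S.plusCoe p (∑ n ∈ Finset.range N, x n • S.ePlus p n) = trunc N x := by
  rw [map_sum]
  exact Finset.sum_congr rfl fun n _ => map_smul _ _ _

lemma IsPowerScale.exists_bound_plus (hS : S.IsPowerScale r c) (hp1 : 1 ≤ p) (hp : p < ∞) {a : ℝ}
    (ha : a < c + (p⁻¹).toReal) (x : S.Plus p) : ∃ M, WeightedBound r a x M := by
  obtain ⟨q, hpq, hq⟩ := exists_exponent_gt hp1 hp (s := a - c) (by linarith)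
  obtain ⟨C, -, h⟩ := hS.upper q a (by linarith)
  exact ⟨_, h (S.plusToStep p ⟨q, hpq⟩ x)⟩

/-- The weighted inclusion of `X(p+)` into `ℓ_r`. -/
def plusToLp (hS : S.IsPowerScale r c) (hp1 : 1 ≤ p) (hp : p < ∞) {a : ℝ}
    (ha : a < c + (p⁻¹).toReal) : S.Plus p →ₗ[ℂ] lp (fun _ : ℕ => ℂ) r where
  toFun x := ⟨wmul a x, (hS.exists_bound_plus hp1 hp ha x).choose_spec.1⟩
  map_add' x y := Subtype.ext (wmul_add a x y)
  map_smul' k x := Subtype.ext (wmul_smul a k x)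

lemma weightedBound_norm_plusToLp (hS : S.IsPowerScale r c) (hp1 : 1 ≤ p)
    (hp : p < ∞) {a : ℝ} (ha : a < c + (p⁻¹).toReal) (x : S.Plus p) :
    WeightedBound r a x ‖plusToLp hS hp1 hp ha x‖ :=
  ⟨(plusToLp hS hp1 hp ha x).2, le_rfl⟩

lemma continuous_plusToLp [Fact (1 ≤ r)] (hS : S.IsPowerScale r c) (hp1 : 1 ≤ p)
    (hp : p < ∞) {a : ℝ} (ha : a < c + (p⁻¹).toReal) :
    Continuous (plusToLp hS hp1 hp ha) := by
  obtain ⟨q, hpq, hq⟩ := exists_exponent_gt hp1 hp (s := a - c) (by linarith)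
  obtain ⟨C, -, h⟩ := hS.upper q a (by linarith)
  let T : S.Step q →ₗ[ℂ] lp (fun _ : ℕ => ℂ) r :=
    { toFun := fun x => ⟨wmul a x.1, (h x).1⟩
      map_add' := fun x y => Subtype.ext (wmul_add a x.1 y.1)
      map_smul' := fun k x => Subtype.ext (wmul_smul a k x.1) }
  have hT : Continuous T := AddMonoidHomClass.continuous_of_bound T C fun x => (h x).2
  exact hT.comp (S.continuous_plusToStep ⟨q, hpq⟩)

/-- For each `q > p` there is room for a weight exponent strictly between `c + 1/q` and `c + 1/p`.
-/
lemma mem_plusSubmodule (hS : S.IsPowerScale r c) (hp1 : 1 ≤ p) {x : ℕ → ℂ}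
    (h : ∀ a < c + (p⁻¹).toReal, ∃ M, WeightedBound r a x M) : x ∈ S.plusSubmodule p := by
  intro q hq
  obtain ⟨a, h1, h2⟩ := exists_between (add_lt_add_right
    (toReal_inv_lt_toReal_inv (zero_lt_one.trans_le hp1).ne' hq) c)
  obtain ⟨M, hM⟩ := h a h2
  obtain ⟨C, -, hC⟩ := hS.lower q a h1
  exact (hC x M hM).1

/-- With `continuous_plusToLp`, this lets the weighted `ℓ_r`-norms of subcritical exponent replace
the norms of the `X(q)`. -/
lemma exists_weightedBound_of_mem_nhds [Fact (1 ≤ r)] (hS : S.IsPowerScale r c) (hp1 : 1 ≤ p)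
    {U : Set (S.Plus p)} (hU : U ∈ 𝓝 0) :
    ∃ a < c + (p⁻¹).toReal, ∃ ε > 0, ∀ (x : S.Plus p) M, WeightedBound r a x M → M < ε → x ∈ U := by
  -- The sets that contain a weighted ball form a filter (for intersections, take the larger
  -- exponent and the smaller radius), so comparison with `𝓝 0` can be made for each norm
  -- separately.
  let 𝓕 : Filter (S.Plus p) :=
    { sets := {U | ∃ a < c + (p⁻¹).toReal, ∃ ε > 0,
        ∀ (x : S.Plus p) M, WeightedBound r a x M → M < ε → x ∈ U}
      univ_sets := ⟨c + (p⁻¹).toReal - 1, by linarith, 1, one_pos, fun _ _ _ _ => trivial⟩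
      sets_of_superset := by
        rintro U V ⟨a, ha, ε, hε, h⟩ hUV
        exact ⟨a, ha, ε, hε, fun x M h1 h2 => hUV (h x M h1 h2)⟩
      inter_sets := by
        rintro U V ⟨a, ha, ε, hε, h⟩ ⟨b, hb, δ, hδ, h'⟩
        refine ⟨max a b, max_lt ha hb, min ε δ, lt_min hε hδ, fun x M h1 h2 => ⟨?_, ?_⟩⟩
        · exact h x M (h1.anti (le_max_left _ _)) (h2.trans_le (min_le_left _ _))
        · exact h' x M (h1.anti (le_max_right _ _)) (h2.trans_le (min_le_right _ _)) }
  have h𝓕 : 𝓕 ≤ 𝓝 0 := by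
    rw [nhds_iInf]
    refine le_iInf fun q => ?_
    rw [nhds_induced, ← tendsto_iff_comap]
    refine (Metric.nhds_basis_ball.tendsto_right_iff).2 fun δ hδ => ?_
    obtain ⟨a, h1, h2⟩ := exists_between (add_lt_add_right
      (toReal_inv_lt_toReal_inv (zero_lt_one.trans_le hp1).ne' q.2) c)
    obtain ⟨C, hC0, hC⟩ := hS.lower q a h1
    refine ⟨a, h2, δ / (C + 1), by positivity, fun x M hx hM => ?_⟩
    have hle : ‖S.plusToStep p q x‖ ≤ C * M := (hC x M hx).2
    have h0 : S.plusToStep p q 0 = 0 := map_zero (S.plusToStepₗ p q)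
    change S.plusToStep p q x ∈ Metric.ball (S.plusToStep p q 0) δ
    rw [h0, mem_ball_zero_iff]
    rw [lt_div_iff₀ (by positivity)] at hM
    have := hx.nonneg
    linarith
  exact h𝓕 hU

/-- A neighbourhood only sees some exponent `a < c + 1/p`, while `x` is bounded for a larger
exponent `b`, so its tails vanish in the weaker norm. -/
lemma tendsto_sum_ePlus [Fact (1 ≤ r)] (hS : S.IsPowerScale r c) (hp1 : 1 ≤ p) (hp : p < ∞)
    (x : S.Plus p) :
    Tendsto (fun N => ∑ n ∈ Finset.range N, x n • S.ePlus p n) atTop (𝓝 x) := by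
  rw [← tendsto_sub_nhds_zero_iff, ← neg_zero, ← tendsto_neg_iff, neg_neg]
  intro U hU
  obtain ⟨a, ha, ε, hε, h⟩ := exists_weightedBound_of_mem_nhds hS hp1 hU
  obtain ⟨b, hab, hb⟩ := exists_between ha
  obtain ⟨M, hM⟩ := hS.exists_bound_plus hp1 hp hb x
  refine mem_map.2 ?_
  filter_upwards [eventually_weight_mul_lt (sub_neg.2 hab) M hε] with N hN
  refine h _ _ ?_ hN
  have := hM.sub_trunc hab.le N
  rwa [← plusCoe_sum_ePlus (S := S) (p := p), ← neg_sub] at this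

/-- The weighted inclusions of `X(p+)` into `ℓ_r`, for a sequence of exponents of the weights that
increases to `c + 1 / p`. -/
def plusToPi (hS : S.IsPowerScale r c) (hp1 : 1 ≤ p) (hp : p < ∞) :
    S.Plus p →ₗ[ℂ] ℕ → lp (fun _ : ℕ => ℂ) r :=
  LinearMap.pi fun k => plusToLp hS hp1 hp
    (a := c + (p⁻¹).toReal - 1 / ((k : ℝ) + 1)) (sub_lt_self _ (by positivity))

lemma isClosedEmbedding_plusToPi [Fact (1 ≤ r)] (hS : S.IsPowerScale r c) (hp1 : 1 ≤ p)
    (hp : p < ∞) : IsClosedEmbedding (plusToPi hS hp1 hp) := by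
  set t := c + (p⁻¹).toReal with ht
  have hk : ∀ a < t, ∃ k : ℕ, a ≤ t - 1 / ((k : ℝ) + 1) := fun a ha => by
    obtain ⟨k, hk⟩ := exists_nat_one_div_lt (sub_pos.2 ha)
    exact ⟨k, by linarith⟩
  have hind : IsInducing (plusToPi hS hp1 hp) := by
    refine IsTopologicalAddGroup.isInducing_iff_nhds_zero.2 (le_antisymm ?_ fun U hU => ?_)
    · rw [← tendsto_iff_comap]
      have hc : Continuous (plusToPi hS hp1 hp) :=
        continuous_pi fun k => continuous_plusToLp hS hp1 hp (sub_lt_self _ (by positivity))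
      simpa using hc.tendsto 0
    · obtain ⟨a, ha, ε, hε, h⟩ := exists_weightedBound_of_mem_nhds hS hp1 hU
      obtain ⟨k, hk⟩ := hk a ha
      refine ⟨{y | y k ∈ Metric.ball 0 ε}, (continuous_apply k).continuousAt.preimage_mem_nhds
        (Metric.ball_mem_nhds _ hε), fun x hx => ?_⟩
      have hlt : t - 1 / ((k : ℝ) + 1) < c + (p⁻¹).toReal := sub_lt_self _ (by positivity)
      exact h x _ ((weightedBound_norm_plusToLp hS hp1 hp hlt x).anti hk) (mem_ball_zero_iff.1 hx)
  have hinj : Function.Injective (plusToPi hS hp1 hp) := fun x y hxy => by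
    refine Subtype.ext (funext fun n => ?_)
    have h : (plusToPi hS hp1 hp x 0) n = (plusToPi hS hp1 hp y 0) n := by rw [hxy]
    exact mul_left_cancel₀ (Complex.ofReal_ne_zero.2 (weight_pos _ n).ne') h
  refine ⟨⟨hind, hinj⟩, ?_⟩
  -- The range consists of the families whose components, once the weights are removed, are one and
  -- the same sequence (that of component `0`). These are closed conditions, as evaluation at a
  -- coordinate is continuous on `ℓ_r`.
  have hrange : Set.range (plusToPi hS hp1 hp) = ⋂ (k : ℕ) (n : ℕ),
      {y | (weight (-(t - 1 / ((k : ℝ) + 1))) n : ℂ) * lp.evalCLM ℂ (fun _ : ℕ => ℂ) r n (y k) =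
        (weight (-(t - 1 / (((0 : ℕ) : ℝ) + 1))) n : ℂ) *
          lp.evalCLM ℂ (fun _ : ℕ => ℂ) r n (y 0)} := by
    have hcancel : ∀ (a : ℝ) (n : ℕ) (z : ℂ), (weight (-a) n : ℂ) * (weight a n * z) = z :=
      fun a n z => by
        rw [← mul_assoc, ← Complex.ofReal_mul, weight_neg_mul_self, Complex.ofReal_one, one_mul]
    have hcancel' : ∀ (a : ℝ) (n : ℕ) (z : ℂ), (weight a n : ℂ) * (weight (-a) n * z) = z :=
      fun a n z => by
        rw [← mul_assoc, ← Complex.ofReal_mul, weight_mul_neg_self, Complex.ofReal_one, one_mul]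
    ext y
    simp only [Set.mem_range, Set.mem_iInter, Set.mem_ofPred_eq]
    constructor
    · rintro ⟨x, rfl⟩ k n
      exact (hcancel _ n (x n)).trans (hcancel _ n (x n)).symm
    · intro h
      let x : ℕ → ℂ := fun n =>
        (weight (-(t - 1 / (((0 : ℕ) : ℝ) + 1))) n : ℂ) * lp.evalCLM ℂ (fun _ : ℕ => ℂ) r n (y 0)
      have hxy : ∀ k : ℕ, wmul (t - 1 / ((k : ℝ) + 1)) x = y k := fun k => by
        funext n
        simp only [wmul, x]
        rw [← h k n, hcancel']
        rfl
      have hx : x ∈ S.plusSubmodule p := mem_plusSubmodule hS hp1 fun a ha => by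
        obtain ⟨k, hk⟩ := hk a ha
        exact ⟨_, WeightedBound.anti ⟨by rw [hxy k]; exact (y k).2, le_rfl⟩ hk⟩
      exact ⟨⟨x, hx⟩, funext fun k => Subtype.ext (hxy k)⟩
  rw [hrange]
  refine isClosed_iInter fun k => isClosed_iInter fun n => isClosed_eq ?_ ?_
  · exact continuous_const.mul ((lp.evalCLM ℂ (fun _ : ℕ => ℂ) r n).continuous.comp
      (continuous_apply k))
  · exact continuous_const.mul ((lp.evalCLM ℂ (fun _ : ℕ => ℂ) r n).continuous.comp
      (continuous_apply 0))

theorem isFrechet_plus [Fact (1 ≤ r)] (hS : S.IsPowerScale r c) (hp1 : 1 ≤ p) (hp : p < ∞) :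
    IsFrechet (S.Plus p) :=
  .of_isClosedEmbedding (plusToPi hS hp1 hp).toAddMonoidHom (isClosedEmbedding_plusToPi hS hp1 hp)

/-- The unit ball for a larger exponent `b` is precompact for a smaller exponent `a`: the tails are
uniformly small, and the truncations stay in a compact set. -/
theorem isFrechetSchwartz_plus [Fact (1 ≤ r)] (hS : S.IsPowerScale r c) (hp1 : 1 ≤ p)
    (hp : p < ∞) : IsFrechetSchwartz (S.Plus p) where
  toIsFrechet := isFrechet_plus hS hp1 hp
  schwartz U hU := by
    obtain ⟨a, ha, δ, hδ, h⟩ := exists_weightedBound_of_mem_nhds hS hp1 hU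
    obtain ⟨b, hab, hb⟩ := exists_between ha
    refine ⟨plusToLp hS hp1 hp hb ⁻¹' Metric.ball 0 1,
      (continuous_plusToLp hS hp1 hp hb).continuousAt.preimage_mem_nhds
        (by rw [map_zero]; exact Metric.ball_mem_nhds _ one_pos), fun ε hε => ?_⟩
    -- Half of `ε * δ` is spent on the tail, half on covering the truncations.
    have hη : 0 < ε * δ / 2 := by positivity
    obtain ⟨N, hN⟩ := (eventually_weight_mul_lt (sub_neg.2 hab) 1 hη).exists
    let F : (ℕ → ℂ) → S.Plus p := fun z => ∑ n ∈ Finset.range N, z n • S.ePlus p n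
    have hF : Continuous F := continuous_finsetSum _ fun n _ =>
      (continuous_apply n).smul continuous_const
    -- The `b`-unit ball lies coordinatewise in these discs; their product is compact by Tychonoff,
    -- and `F` uses only the first `N` coordinates.
    have hK : IsCompact (F '' Set.univ.pi fun n => Metric.closedBall 0 (weight (-b) n)) :=
      (isCompact_univ_pi fun n => isCompact_closedBall _ _).image hF
    let Ω : Set (S.Plus p) := plusToLp hS hp1 hp ha ⁻¹' Metric.ball 0 (ε * δ / 2)
    have hΩ : Ω ∈ 𝓝 0 := (continuous_plusToLp hS hp1 hp ha).continuousAt.preimage_mem_nhds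
      (by rw [map_zero]; exact Metric.ball_mem_nhds _ hη)
    obtain ⟨s, -, hs⟩ := hK.elim_nhds_subcover (fun y => (fun z => z - y) ⁻¹' Ω) fun y _ =>
      (continuous_id.sub continuous_const).continuousAt.preimage_mem_nhds
        (by simpa using hΩ)
    refine ⟨s, fun v hv => ?_⟩
    have hvb : WeightedBound r b v 1 := (weightedBound_norm_plusToLp hS hp1 hp hb v).mono_const
      (mem_ball_zero_iff.1 hv).le
    have hvF : F v ∈ F '' Set.univ.pi fun n => Metric.closedBall 0 (weight (-b) n) := by
      refine Set.mem_image_of_mem _ fun n _ => mem_closedBall_zero_iff.2 ?_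
      have := mul_le_mul_of_nonneg_left (hvb.coord_le n) (weight_pos (-b) n).le
      rwa [← mul_assoc, weight_neg_mul_self, one_mul, mul_one] at this
    obtain ⟨y, hy, hyv⟩ := Set.mem_iUnion₂.1 (hs hvF)
    refine ⟨y, hy, (ε⁻¹ : ℂ) • (v - y), ?_, ?_⟩
    · have h1 : WeightedBound r a (v - F v : S.Plus p) (weight (a - b) N * 1) := by
        have := hvb.sub_trunc hab.le N
        rwa [← plusCoe_sum_ePlus (S := S) (p := p)] at this
      have h2 : WeightedBound r a (F v - y : S.Plus p) (ε * δ / 2) :=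
        (weightedBound_norm_plusToLp hS hp1 hp ha _).mono_const (mem_ball_zero_iff.1 hyv).le
      have h3 := (h1.add h2).smul (ε⁻¹ : ℂ)
      have h4 : ((v - F v : S.Plus p) : ℕ → ℂ) + (F v - y : S.Plus p) = (v - y : S.Plus p) :=
        congrArg Subtype.val (sub_add_sub_cancel v (F v) y)
      rw [h4] at h3
      refine h _ _ h3 ?_
      rw [norm_inv, Complex.norm_real, Real.norm_of_nonneg hε.le, inv_mul_lt_iff₀ hε]
      linarith
    · rw [← Complex.coe_smul, smul_smul, mul_inv_cancel₀ (Complex.ofReal_ne_zero.2 hε.ne'),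
        one_smul, add_sub_cancel]

lemma isVonNBounded_plus [Fact (1 ≤ r)] (hS : S.IsPowerScale r c) (hp1 : 1 ≤ p)
    {B : Set (S.Plus p)}
    (hB : ∀ a < c + (p⁻¹).toReal, ∃ M, ∀ x ∈ B, WeightedBound r a x M) :
    Bornology.IsVonNBounded ℂ B := by
  intro U hU
  obtain ⟨a, ha, ε, hε, h⟩ := exists_weightedBound_of_mem_nhds hS hp1 hU
  obtain ⟨M, hM⟩ := hB a ha
  -- The summand `1` makes `k` nonzero and `M < ‖k‖ * ε` strict.
  refine absorbs_iff_norm.2 ⟨|M| / ε + 1, fun k hk x hx => ?_⟩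
  have hk0 : 0 < ‖k‖ := lt_of_lt_of_le (by positivity) hk
  refine (Set.mem_smul_set_iff_inv_smul_mem₀ (norm_pos_iff.1 hk0) _ _).2
    (h _ _ ((hM x hx).smul k⁻¹) ?_)
  rw [norm_inv, inv_mul_lt_iff₀ hk0]
  calc M ≤ |M| / ε * ε := by rw [div_mul_cancel₀ _ hε.ne']; exact le_abs_self M
    _ < ‖k‖ * ε := by gcongr; linarith

lemma exists_bound_of_isVonNBounded_plus [Fact (1 ≤ r)] (hS : S.IsPowerScale r c) (hp1 : 1 ≤ p)
    (hp : p < ∞) {B : Set (S.Plus p)} (hB : Bornology.IsVonNBounded ℂ B) {a : ℝ}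
    (ha : a < c + (p⁻¹).toReal) : ∃ M, ∀ x ∈ B, WeightedBound r a x M := by
  have h := hB.image (⟨plusToLp hS hp1 hp ha, continuous_plusToLp hS hp1 hp ha⟩ :
    S.Plus p →L[ℂ] lp (fun _ : ℕ => ℂ) r)
  obtain ⟨M, hM⟩ := (NormedSpace.isVonNBounded_iff' ℂ).1 h
  exact ⟨M, fun x hx => (weightedBound_norm_plusToLp hS hp1 hp ha x).mono_const
    (hM _ (Set.mem_image_of_mem _ hx))⟩

end Plus

/-! ### The spaces `X(p-)` -/

section Minus

variable {p : ℝ≥0∞} {hp : 1 < p}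

variable (S p hp) in
/-- The inclusion of `X(q)` into `X(p-)`, as a linear map. -/
def stepToMinusₗ (q : {q : Exponent // q < p}) : S.Step q →ₗ[ℂ] S.Minus p hp where
  toFun := S.stepToMinus p hp q
  map_add' _ _ := rfl
  map_smul' _ _ := rfl

variable (S p hp) in
/-- The inclusion of `X(p-)` into the space of all sequences. -/
def minusCoe : S.Minus p hp →ₗ[ℂ] ℕ → ℂ := (S.minusSubmodule p hp).subtype

instance : IsTopologicalAddGroup (S.Minus p hp) := topologicalAddGroup_sInf fun _ h => h.1

instance : ContinuousSMul ℂ (S.Minus p hp) := continuousSMul_sInf fun _ h => h.2.1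

instance : LocallyConvexSpace ℝ (S.Minus p hp) := .sInf fun _ h => h.2.2.1

lemma continuous_stepToMinus (q : {q : Exponent // q < p}) : Continuous (S.stepToMinus p hp q) :=
  continuous_sInf_rng.2 fun _ h => h.2.2.2 q

/-- The universal property of the inductive limit: the topology induced by `T` is one of the
competing locally convex topologies. -/
lemma continuous_of_comp_stepToMinus {F : Type*} [AddCommGroup F] [Module ℂ F] [TopologicalSpace F]
    [IsTopologicalAddGroup F] [ContinuousSMul ℂ F] [LocallyConvexSpace ℝ F]
    (T : S.Minus p hp →ₗ[ℂ] F) (h : ∀ q, Continuous fun x => T (S.stepToMinus p hp q x)) :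
    Continuous T := by
  refine continuous_iff_le_induced.2 (sInf_le ⟨topologicalAddGroup_induced T,
    continuousSMul_induced T, .induced (T.restrictScalars ℝ), fun q => continuous_induced_rng.2 ?_⟩)
  exact h q

lemma minusCoe_sum_eMinus (N : ℕ) (x : ℕ → ℂ) :
    S.minusCoe p hp (∑ n ∈ Finset.range N, x n • S.eMinus p hp n) = trunc N x := by
  rw [map_sum]
  exact Finset.sum_congr rfl fun n _ => map_smul _ _ _

lemma IsPowerScale.exists_bound_minus (hS : S.IsPowerScale r c) (x : S.Minus p hp) :
    ∃ a > c + (p⁻¹).toReal, ∃ M, WeightedBound r a x M := by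
  obtain ⟨q, hq, hx⟩ := x.2
  obtain ⟨a, h1, h2⟩ := exists_between (add_lt_add_right
    (toReal_inv_lt_toReal_inv (exponent_ne_zero q) hq) c)
  obtain ⟨C, -, h⟩ := hS.upper q a h2
  exact ⟨a, h1, _, h ⟨x.1, hx⟩⟩

lemma mem_minusSubmodule (hS : S.IsPowerScale r c) {x : ℕ → ℂ} {a M : ℝ}
    (ha : c + (p⁻¹).toReal < a) (h : WeightedBound r a x M) : x ∈ S.minusSubmodule p hp := by
  obtain ⟨q, hq, hqa⟩ := exists_exponent_lt hp (s := a - c) (by linarith)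
  obtain ⟨C, -, hC⟩ := hS.lower q a (by linarith)
  exact ⟨q, hq, (hC x M h).1⟩

/-- The weighted space of supercritical exponent `a` embeds continuously in some `X(q)` with `q <
p`, hence in `X(p-)`. -/
lemma exists_mem_of_mem_nhds_minus (hS : S.IsPowerScale r c) {a : ℝ} (ha : c + (p⁻¹).toReal < a)
    {U : Set (S.Minus p hp)} (hU : U ∈ 𝓝 0) :
    ∃ ε > 0, ∀ (x : S.Minus p hp) M, WeightedBound r a x M → M < ε → x ∈ U := by
  obtain ⟨q, hq, hqa⟩ := exists_exponent_lt hp (s := a - c) (by linarith)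
  obtain ⟨C, hC0, hC⟩ := hS.lower q a (by linarith)
  have h0 : S.stepToMinus p hp ⟨q, hq⟩ 0 = 0 := map_zero (S.stepToMinusₗ p hp ⟨q, hq⟩)
  obtain ⟨δ, hδ, h⟩ := Metric.mem_nhds_iff.1
    ((S.continuous_stepToMinus (hp := hp) ⟨q, hq⟩).continuousAt.preimage_mem_nhds (by rwa [h0]))
  refine ⟨δ / (C + 1), by positivity, fun x M hx hM => ?_⟩
  obtain ⟨hxq, hle⟩ := hC x M hx
  let z : S.Step q := ⟨x.1, hxq⟩
  have hz : ‖z‖ < δ := by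
    refine lt_of_le_of_lt hle ?_
    rw [lt_div_iff₀ (by positivity)] at hM
    have := hx.nonneg
    linarith
  exact h (mem_ball_zero_iff.2 hz)

lemma tendsto_sum_eMinus [Fact (1 ≤ r)] (hS : S.IsPowerScale r c) (x : S.Minus p hp) :
    Tendsto (fun N => ∑ n ∈ Finset.range N, x n • S.eMinus p hp n) atTop (𝓝 x) := by
  rw [← tendsto_sub_nhds_zero_iff, ← neg_zero, ← tendsto_neg_iff, neg_neg]
  intro U hU
  obtain ⟨b, hb, M, hM⟩ := hS.exists_bound_minus x
  obtain ⟨a, ha, hab⟩ := exists_between hb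
  obtain ⟨ε, hε, h⟩ := exists_mem_of_mem_nhds_minus hS ha hU
  refine mem_map.2 ?_
  filter_upwards [eventually_weight_mul_lt (sub_neg.2 hab) M hε] with N hN
  refine h _ _ ?_ hN
  have := hM.sub_trunc hab.le N
  rwa [← minusCoe_sum_eMinus (S := S) (hp := hp), ← neg_sub] at this

variable (S) in
/-- The inclusion of `X(q)` into `X(q')` for `q ≤ q'`. -/
def stepInclusion {q q' : Exponent} (h : q ≤ q') : S.Step q →ₗ[ℂ] S.Step q' where
  toFun x := ⟨x.1, S.mono h x.2⟩
  map_add' _ _ := rfl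
  map_smul' _ _ := rfl

/-- The inclusion factors through a weighted `ℓ_r`-space with exponent strictly between `c + 1/q'`
and `c + 1/q`. -/
lemma continuous_stepInclusion (hS : S.IsPowerScale r c) {q q' : Exponent} (h : q < q') :
    Continuous (S.stepInclusion h.le) := by
  obtain ⟨a, h1, h2⟩ := exists_between (add_lt_add_right
    (toReal_inv_lt_toReal_inv (exponent_ne_zero q) h) c)
  obtain ⟨C, -, hC⟩ := hS.upper q a h2
  obtain ⟨C', -, hC'⟩ := hS.lower q' a h1
  exact AddMonoidHomClass.continuous_of_bound _ (C' * C) fun x =>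
    ((hC' x.1 _ (hC x)).2).trans_eq (mul_assoc _ _ _).symm

/-- `X(p-)` is the inductive limit of `X(s k)` for every sequence `s k` that tends to `p` from
below. -/
theorem minus_eq_inductiveLimit (hS : S.IsPowerScale r c) (s : ℕ → Exponent) (hs : ∀ k, s k < p)
    (hlim : Tendsto (fun k => (s k : ℝ≥0∞)) atTop (𝓝 p)) :
    (∀ x : S.Minus p hp, ∃ k, (x : ℕ → ℂ) ∈ S.space (s k)) ∧
      (inferInstance : TopologicalSpace (S.Minus p hp)) =
        inductiveLimitTopology (fun k => S.stepToMinus p hp ⟨s k, hs k⟩) := by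
  have hk : ∀ q : Exponent, q < p → ∃ k, q < s k := fun q hq =>
    (hlim.eventually (lt_mem_nhds hq)).exists
  refine ⟨fun x => ?_, ?_⟩
  · obtain ⟨q, hq, hx⟩ := x.2
    obtain ⟨k, hk⟩ := hk q hq
    exact ⟨k, S.mono hk.le hx⟩
  · refine congrArg sInf (Set.ext fun t => ?_)
    refine and_congr_right fun _ => and_congr_right fun _ => and_congr_right fun _ =>
      ⟨fun h k => h _, fun h q => ?_⟩
    obtain ⟨k, hk⟩ := hk q q.2
    exact (h k).comp (continuous_stepInclusion hS hk)

end Minus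

end SequenceScale

/-! ### Barrelledness, seminorms and Hahn–Banach -/

lemma IsFrechet.barrelledSpace {E : Type*} [AddCommGroup E] [Module ℂ E] [TopologicalSpace E]
    (hE : IsFrechet E) : BarrelledSpace ℂ E := by
  have := hE.topologicalAddGroup
  have := hE.continuousSMul
  have := hE.metrizable
  let : UniformSpace E := IsTopologicalAddGroup.rightUniformSpace E
  have : IsUniformAddGroup E := isUniformAddGroup_of_addCommGroup
  have : CompleteSpace E := hE.complete
  have : (uniformity E).IsCountablyGenerated := IsUniformAddGroup.uniformity_countably_generated
  infer_instance

open scoped ComplexOrder in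
lemma polynormableSpace_of_locallyConvexSpace_real (E : Type*) [AddCommGroup E] [Module ℂ E]
    [TopologicalSpace E] [IsTopologicalAddGroup E] [ContinuousSMul ℂ E] [LocallyConvexSpace ℝ E] :
    PolynormableSpace ℂ E := by
  have : LocallyConvexSpace ℂ E := ⟨fun x => by
    simpa only [convex_RCLike_iff_convex_real] using LocallyConvexSpace.convex_basis (𝕜 := ℝ) x⟩
  have : ContinuousSMul ℝ E := IsScalarTower.continuousSMul ℂ
  exact LocallyConvexSpace.toPolynormableSpace

/-- Hahn–Banach extension of `k • x ↦ k * P x` from the line spanned by `x`. -/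
lemma exists_dual_eq_seminorm {E : Type*} [AddCommGroup E] [Module ℂ E] (P : Seminorm ℂ E)
    (x : E) : ∃ g : E →ₗ[ℂ] ℂ, g x = P x ∧ ∀ z, ‖g z‖ ≤ P z := by
  rcases eq_or_ne (P x) 0 with h0 | h0
  · exact ⟨0, by simp [h0], fun z => by simp⟩
  have hx : x ≠ 0 := fun h => h0 (by rw [h, map_zero])
  let e := LinearEquiv.toSpanNonzeroSingleton ℂ E x hx
  have he : ∀ k : ℂ, ((e k : Submodule.span ℂ {x}) : E) = k • x := fun k => rfl
  obtain ⟨g, hg, hgP⟩ := Module.Dual.exists_extension_of_le_seminorm (Submodule.span ℂ {x})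
    ((P x : ℂ) • e.symm.toLinearMap) (p := P) fun z => by
      obtain ⟨k, rfl⟩ := e.surjective z
      rw [he, map_smul_eq_mul]
      simp [abs_of_nonneg (apply_nonneg P x), mul_comm]
  refine ⟨g, ?_, hgP⟩
  have h := hg (e 1)
  rw [he, one_smul] at h
  simpa using h

lemma Seminorm.continuous_of_norm_le {E : Type*} [AddCommGroup E] [Module ℂ E]
    [TopologicalSpace E] [IsTopologicalAddGroup E] {P : Seminorm ℂ E} (hP : Continuous P)
    {g : E →ₗ[ℂ] ℂ} (hg : ∀ z, ‖g z‖ ≤ P z) : Continuous g := by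
  refine continuous_of_continuousAt_zero g ?_
  rw [ContinuousAt, map_zero]
  exact squeeze_zero_norm hg (by simpa using hP.tendsto 0)

/-! ### The pairing of weighted `ℓ_1` and weighted `ℓ_∞` -/

section pairing

variable {a M M' : ℝ} {x y : ℕ → ℂ}

lemma sum_norm_mul_le (hx : WeightedBound 1 a x M) (hy : WeightedBound ∞ (-a) y M') (N : ℕ) :
    ∑ n ∈ Finset.range N, ‖x n * y n‖ ≤ M * M' := by
  refine le_trans ?_ (mul_le_mul_of_nonneg_right (weightedBound_one.1 hx N) hy.nonneg)
  rw [Finset.sum_mul]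
  refine Finset.sum_le_sum fun n _ => ?_
  calc ‖x n * y n‖ = (weight a n * ‖x n‖) * (weight (-a) n * ‖y n‖) := by
        rw [norm_mul, mul_mul_mul_comm, weight_mul_neg_self, one_mul]
    _ ≤ _ := mul_le_mul_of_nonneg_left (weightedBound_top.1 hy n)
        (mul_nonneg (weight_pos a n).le (norm_nonneg _))

lemma summable_norm_mul (hx : WeightedBound 1 a x M) (hy : WeightedBound ∞ (-a) y M') :
    Summable fun n => ‖x n * y n‖ :=
  summable_of_sum_range_le (fun _ => norm_nonneg _) (sum_norm_mul_le hx hy)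

lemma norm_tsum_mul_le (hx : WeightedBound 1 a x M) (hy : WeightedBound ∞ (-a) y M') :
    ‖∑' n, x n * y n‖ ≤ M * M' :=
  (norm_tsum_le_tsum_norm (summable_norm_mul hx hy)).trans
    (Real.tsum_le_of_sum_range_le (fun _ => norm_nonneg _) (sum_norm_mul_le hx hy))

lemma weightedBound_one_single (a : ℝ) (n : ℕ) :
    WeightedBound 1 a (Pi.single n 1) (weight a n) := by
  refine weightedBound_one.2 fun N => ?_
  have h : ∀ k, weight a k * ‖(Pi.single n 1 : ℕ → ℂ) k‖ = if k = n then weight a n else 0 :=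
    fun k => by
      by_cases hk : k = n
      · subst hk; simp
      · simp [hk]
  simp_rw [h, Finset.sum_ite_eq']
  split_ifs
  exacts [le_rfl, (weight_pos a n).le]

lemma tsum_single_mul (y : ℕ → ℂ) (n : ℕ) :
    ∑' m, (Pi.single n 1 : ℕ → ℂ) m * y m = y n := by
  rw [tsum_eq_single n fun m hm => by simp [hm]]
  simp

/-- A linear functional on sequences whose values are small on a ball of a weighted `ℓ_1`-norm has
coefficients in the dual weighted `ℓ_∞`-space. -/
lemma weightedBound_top_of_functional {E : Type*} [AddCommGroup E] [Module ℂ E]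
    (ι : E →ₗ[ℂ] ℕ → ℂ) (e : ℕ → E) (he : ∀ n, ι (e n) = Pi.single n 1) (f : E →ₗ[ℂ] ℂ)
    {ε : ℝ} (hε : 0 < ε) (h : ∀ x M, WeightedBound 1 a (ι x) M → M < ε → ‖f x‖ < 1) :
    WeightedBound ∞ (-a) (fun n => f (e n)) (2 / ε) := by
  refine weightedBound_top.2 fun n => ?_
  have h1 := (weightedBound_one_single a n).smul ((ε / 2 * weight (-a) n : ℝ) : ℂ)
  have h0 : 0 ≤ ε / 2 * weight (-a) n := mul_nonneg (by positivity) (weight_pos _ _).le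
  rw [← he, ← map_smul, Complex.norm_real, Real.norm_of_nonneg h0, mul_assoc,
    weight_neg_mul_self, mul_one] at h1
  have h2 := h _ _ h1 (by linarith)
  rw [map_smul, norm_smul, Complex.norm_real, Real.norm_of_nonneg h0] at h2
  rw [le_div_iff₀ hε]
  linarith

/-- The bilinear form `∑ x_n y_n` on two spaces of sequences. -/
def pairing {E F : Type*} [AddCommGroup E] [Module ℂ E] [AddCommGroup F] [Module ℂ F]
    (ι : E →ₗ[ℂ] ℕ → ℂ) (κ : F →ₗ[ℂ] ℕ → ℂ) (h : ∀ x y, Summable fun n => ι x n * κ y n) :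
    E →ₗ[ℂ] F →ₗ[ℂ] ℂ :=
  LinearMap.mk₂ ℂ (fun x y => ∑' n, ι x n * κ y n)
    (fun x x' y => by
      rw [← (h x y).tsum_add (h x' y)]
      exact tsum_congr fun n => by rw [map_add, Pi.add_apply, add_mul])
    (fun k x y => by
      rw [smul_eq_mul, ← tsum_mul_left]
      exact tsum_congr fun n => by rw [map_smul, Pi.smul_apply, smul_eq_mul, mul_assoc])
    (fun x y y' => by
      rw [← (h x y).tsum_add (h x y')]
      exact tsum_congr fun n => by rw [map_add, Pi.add_apply, mul_add])
    (fun k x y => by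
      rw [smul_eq_mul, ← tsum_mul_left]
      exact tsum_congr fun n => by rw [map_smul, Pi.smul_apply, smul_eq_mul, mul_left_comm])

end pairing

namespace SequenceScale

variable {S T : SequenceScale} {c c' : ℝ} {p q : ℝ≥0∞}

lemma continuous_of_norm_le_plusToLp {r : ℝ≥0∞} [Fact (1 ≤ r)] (hS : S.IsPowerScale r c)
    (hq1 : 1 ≤ q) (hq : q < ∞) (f : S.Plus q →ₗ[ℂ] ℂ) {a : ℝ} (ha : a < c + (q⁻¹).toReal)
    (C : ℝ) (h : ∀ x, ‖f x‖ ≤ C * ‖plusToLp hS hq1 hq ha x‖) : Continuous f := by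
  refine continuous_of_continuousAt_zero f ?_
  rw [ContinuousAt, map_zero]
  refine squeeze_zero_norm h ?_
  have hc : Continuous fun x => C * ‖plusToLp hS hq1 hq ha x‖ :=
    continuous_const.mul (continuous_plusToLp hS hq1 hq ha).norm
  simpa using hc.tendsto 0

/-! ### The dual of `X(q+)` -/

section DualPlus

variable {hp : 1 < p}

/-- An element of `Y(p-)` has some exponent `b` strictly above critical; by `hpq`, `-b` is then
strictly below critical for `X(q+)`, where every such exponent is available. -/
lemma exists_bounds_plus_minus (hS : S.IsPowerScale 1 c) (hT : T.IsPowerScale ∞ c')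
    (hq1 : 1 ≤ q) (hq : q < ∞) (hpq : c + (q⁻¹).toReal = -(c' + (p⁻¹).toReal))
    (x : S.Plus q) (y : T.Minus p hp) :
    ∃ a M M', WeightedBound 1 a x M ∧ WeightedBound ∞ (-a) y M' := by
  obtain ⟨b, hb, M', hM'⟩ := hT.exists_bound_minus y
  obtain ⟨M, hM⟩ := hS.exists_bound_plus hq1 hq (a := -b) (by linarith) x
  exact ⟨-b, M, M', hM, by rwa [neg_neg]⟩

/-- The pairing of `X(q+)` with `Y(p-)`. -/
def pairPlusMinus (hS : S.IsPowerScale 1 c) (hT : T.IsPowerScale ∞ c')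
    (hq1 : 1 ≤ q) (hq : q < ∞) (hpq : c + (q⁻¹).toReal = -(c' + (p⁻¹).toReal)) :
    S.Plus q →ₗ[ℂ] T.Minus p hp →ₗ[ℂ] ℂ :=
  pairing (S.plusCoe q) (T.minusCoe p hp) fun x y => by
    obtain ⟨a, M, M', h, h'⟩ := exists_bounds_plus_minus hS hT hq1 hq hpq x y
    exact (summable_norm_mul h h').of_norm

variable (hS : S.IsPowerScale 1 c) (hT : T.IsPowerScale ∞ c')
    (hq1 : 1 ≤ q) (hq : q < ∞) (hpq : c + (q⁻¹).toReal = -(c' + (p⁻¹).toReal))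

lemma norm_pairPlusMinus_le {a M M' : ℝ} {x : S.Plus q} {y : T.Minus p hp}
    (hx : WeightedBound 1 a x M) (hy : WeightedBound ∞ (-a) y M') :
    ‖pairPlusMinus hS hT hq1 hq hpq x y‖ ≤ M * M' := norm_tsum_mul_le hx hy

lemma continuous_pairPlusMinus (y : T.Minus p hp) :
    Continuous ((pairPlusMinus hS hT hq1 hq hpq).flip y) := by
  obtain ⟨b, hb, M', hM'⟩ := hT.exists_bound_minus y
  have hb' : -b < c + (q⁻¹).toReal := by linarith
  refine continuous_of_norm_le_plusToLp hS hq1 hq _ hb' M' fun x => ?_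
  rw [mul_comm]
  exact norm_pairPlusMinus_le hS hT hq1 hq hpq (weightedBound_norm_plusToLp hS hq1 hq hb' x)
    (by rwa [neg_neg])

lemma coeff_mem_minusSubmodule (hS : S.IsPowerScale 1 c) (hT : T.IsPowerScale ∞ c')
    (hq1 : 1 ≤ q) (hpq : c + (q⁻¹).toReal = -(c' + (p⁻¹).toReal)) (f : StrongDual ℂ (S.Plus q)) :
    (fun n => f (S.ePlus q n)) ∈ T.minusSubmodule p hp := by
  obtain ⟨a, ha, ε, hε, h⟩ := exists_weightedBound_of_mem_nhds hS hq1
    (f.continuous.continuousAt.preimage_mem_nhds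
      (by rw [map_zero]; exact Metric.ball_mem_nhds _ one_pos))
  refine mem_minusSubmodule hT (a := -a) (by linarith) (weightedBound_top_of_functional
    (S.plusCoe q) (S.ePlus q) (fun _ => rfl) f.toLinearMap hε fun x M hx hM => ?_)
  exact mem_ball_zero_iff.1 (h x M hx hM)

/-- The coefficient map identifies the dual of `X(q+)` with `Y(p-)`. -/
def dualPlusEquiv : StrongDual ℂ (S.Plus q) ≃ₗ[ℂ] T.Minus p hp where
  toFun f := ⟨fun n => f (S.ePlus q n), coeff_mem_minusSubmodule hS hT hq1 hpq f⟩
  map_add' _ _ := rfl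
  map_smul' _ _ := rfl
  invFun y := ⟨(pairPlusMinus hS hT hq1 hq hpq).flip y,
    continuous_pairPlusMinus hS hT hq1 hq hpq y⟩
  left_inv f := by
    ext x
    obtain ⟨a, M, M', h, h'⟩ := exists_bounds_plus_minus hS hT hq1 hq hpq x
      ⟨fun n => f (S.ePlus q n), coeff_mem_minusSubmodule (hp := hp) hS hT hq1 hpq f⟩
    have h1 := (summable_norm_mul h h').of_norm.hasSum.tendsto_sum_nat
    have h2 := (f.continuous.tendsto x).comp (tendsto_sum_ePlus hS hq1 hq x)
    refine tendsto_nhds_unique h1 (h2.congr fun N => ?_)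
    simp only [Function.comp_apply, map_sum, map_smul, smul_eq_mul]
  right_inv y := Subtype.ext (funext fun n => tsum_single_mul y.1 n)

/-- By the universal property it suffices to look at one step `Y(s)`. Its norm controls some
supercritical exponent `b`, and a bounded set of `X(q+)` is bounded for the exponent `-b`, so the
pairing estimate applies. -/
lemma continuous_dualPlusEquiv_symm :
    Continuous (dualPlusEquiv (hp := hp) hS hT hq1 hq hpq).symm := by
  refine continuous_of_comp_stepToMinus
    (dualPlusEquiv (hp := hp) hS hT hq1 hq hpq).symm.toLinearMap fun s => ?_
  let F : T.Step s →ₗ[ℂ] StrongDual ℂ (S.Plus q) :=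
    (dualPlusEquiv (hp := hp) hS hT hq1 hq hpq).symm.toLinearMap ∘ₗ T.stepToMinusₗ p hp s
  change Continuous F
  refine continuous_of_continuousAt_zero F ?_
  rw [ContinuousAt, map_zero]
  refine (ContinuousLinearMap.hasBasis_nhds_zero_of_basis
    Metric.nhds_basis_ball).tendsto_right_iff.2
    fun ⟨B, δ⟩ ⟨hB, hδ⟩ => ?_
  obtain ⟨b, h1, h2⟩ := exists_between (add_lt_add_right
    (toReal_inv_lt_toReal_inv (exponent_ne_zero s) s.2) c')
  obtain ⟨C, hC0, hC⟩ := hT.upper s b h2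
  obtain ⟨M, hM⟩ := exists_bound_of_isVonNBounded_plus hS hq1 hq hB (a := -b) (by linarith)
  have hpos : 0 < |M| * C + 1 := by positivity
  filter_upwards [Metric.ball_mem_nhds (0 : T.Step s) (div_pos hδ hpos)] with y hy x hx
  rw [mem_ball_zero_iff, lt_div_iff₀ hpos] at hy
  rw [mem_ball_zero_iff]
  have hle : ‖F y x‖ ≤ |M| * (C * ‖y‖) :=
    norm_pairPlusMinus_le hS hT hq1 hq hpq (y := T.stepToMinus p hp s y)
      ((hM x hx).mono_const (le_abs_self M)) (by rw [neg_neg]; exact hC y)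
  have := norm_nonneg y
  nlinarith

/-- The coefficients of the functionals on `Y(p-)` that are dominated by a continuous seminorm
are bounded in a weighted `ℓ_1`-norm. -/
lemma weightedBound_of_le_seminorm (hT : T.IsPowerScale ∞ c') (P : Seminorm ℂ (T.Minus p hp))
    (hP : Continuous P) {a : ℝ} (ha : a < -(c' + (p⁻¹).toReal)) :
    ∃ M, ∀ g : T.Minus p hp →ₗ[ℂ] ℂ, (∀ x, ‖g x‖ ≤ P x) →
      WeightedBound 1 a (fun n => g (T.eMinus p hp n)) M := by
  obtain ⟨ε, hε, h⟩ := exists_mem_of_mem_nhds_minus hT (a := -a) (by linarith)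
    (hP.continuousAt.preimage_mem_nhds (by rw [map_zero]; exact Iio_mem_nhds one_pos))
  refine ⟨2 / ε, fun g hg => weightedBound_one.2 fun N => ?_⟩
  let z : ℕ → ℂ := fun n => g (T.eMinus p hp n)
  -- Extremal test vector: its phases cancel those of `z`, and its moduli keep it in the `ε /
  -- 2`-ball of weighted `ℓ_∞`. Where `z n = 0`, division by zero gives the value `0`.
  let u : ℕ → ℂ := fun n =>
    ((ε / 2 * weight a n : ℝ) : ℂ) * (starRingEnd ℂ (z n) / (‖z n‖ : ℂ))
  have h0 : ∀ n, 0 ≤ ε / 2 * weight a n := fun n =>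
    mul_nonneg (by positivity) (weight_pos _ _).le
  have hu : ∀ n, ‖u n‖ ≤ ε / 2 * weight a n := fun n => by
    simp only [u]
    rw [norm_mul, norm_div, RCLike.norm_conj, Complex.norm_real, Complex.norm_real,
      Real.norm_of_nonneg (h0 n), norm_norm]
    exact mul_le_of_le_one_right (h0 n) (div_self_le_one _)
  have huz : ∀ n, u n * z n = ((ε / 2 * (weight a n * ‖z n‖) : ℝ) : ℂ) := fun n => by
    rcases eq_or_ne (z n) 0 with hz | hz
    · simp [hz]
    · change ((ε / 2 * weight a n : ℝ) : ℂ) * (starRingEnd ℂ (z n) / (‖z n‖ : ℂ)) * z n = _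
      have hz' : (‖z n‖ : ℂ) ≠ 0 := Complex.ofReal_ne_zero.2 (norm_ne_zero_iff.2 hz)
      have hc : starRingEnd ℂ (z n) * z n = (‖z n‖ : ℂ) ^ 2 := Complex.conj_mul' (z n)
      rw [mul_assoc, div_mul_eq_mul_div (starRingEnd ℂ (z n)), hc, sq, mul_div_cancel_right₀ _ hz',
        ← Complex.ofReal_mul, mul_assoc]
  let v : T.Minus p hp := ∑ n ∈ Finset.range N, u n • T.eMinus p hp n
  have hv : WeightedBound ∞ (-a) v (ε / 2) := weightedBound_top.2 fun n => by
    have hvn : v.1 n = trunc N u n := congrFun (minusCoe_sum_eMinus (S := T) (hp := hp) N u) n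
    rw [hvn, trunc_apply]
    split_ifs with hn
    · calc weight (-a) n * ‖u n‖ ≤ weight (-a) n * (ε / 2 * weight a n) :=
            mul_le_mul_of_nonneg_left (hu n) (weight_pos _ _).le
        _ = ε / 2 := by rw [mul_left_comm, weight_neg_mul_self, mul_one]
    · rw [norm_zero, mul_zero]; positivity
  have hgv : g v = ((ε / 2 * ∑ n ∈ Finset.range N, weight a n * ‖z n‖ : ℝ) : ℂ) := by
    simp only [v, map_sum, map_smul, smul_eq_mul]
    rw [Finset.mul_sum, Complex.ofReal_sum]
    exact Finset.sum_congr rfl fun n _ => huz n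
  have h1 : ‖g v‖ < 1 := (hg v).trans_lt (h v _ hv (by linarith))
  rw [hgv, Complex.norm_real] at h1
  have h2 := (le_abs_self _).trans_lt h1
  rw [le_div_iff₀ hε]
  linarith

/-- Bipolar argument: the functionals dominated by a continuous seminorm `P` on `Y(p-)` have
coefficients in a bounded set `B` of `X(q+)`. If `x` corresponds to `f`, Hahn–Banach provides such a
functional with value `P x` at `x`, and this value equals `f y` for some `y ∈ B`. So `f` small on
`B` forces `P x` small. -/
lemma continuous_dualPlusEquiv : Continuous (dualPlusEquiv (hp := hp) hS hT hq1 hq hpq) := by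
  refine continuous_of_continuousAt_zero (dualPlusEquiv (hp := hp) hS hT hq1 hq hpq) ?_
  rw [ContinuousAt, map_zero]
  intro U hU
  have := polynormableSpace_of_locallyConvexSpace_real (T.Minus p hp)
  have hw := PolynormableSpace.withSeminorms ℂ (T.Minus p hp)
  obtain ⟨⟨s, δ⟩, hδ, hsU⟩ := hw.hasBasis_zero_ball.mem_iff.1 hU
  let P : Seminorm ℂ (T.Minus p hp) :=
    s.sup fun P : {P : Seminorm ℂ (T.Minus p hp) // Continuous P} => P.1
  have hP : Continuous P := by
    refine Seminorm.continuous' (r := δ) (mem_of_superset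
      (hw.hasBasis_zero_ball.mem_of_mem (i := (s, δ)) hδ) (P.ball_subset_closedBall _ _))
  let B : Set (S.Plus q) := {y | ∃ g : T.Minus p hp →ₗ[ℂ] ℂ, (∀ x, ‖g x‖ ≤ P x) ∧
    ∀ n, y n = g (T.eMinus p hp n)}
  have hB : Bornology.IsVonNBounded ℂ B := by
    refine isVonNBounded_plus hS hq1 fun a ha => ?_
    obtain ⟨M, hM⟩ := weightedBound_of_le_seminorm hT P hP (a := a) (by linarith)
    refine ⟨M, fun y ⟨g, hg, hy⟩ => ?_⟩
    have : y.1 = fun n => g (T.eMinus p hp n) := funext hy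
    change WeightedBound 1 a y.1 M
    rw [this]
    exact hM g hg
  have hmem := (ContinuousLinearMap.hasBasis_nhds_zero_of_basis (𝕜₁ := ℂ) (E := S.Plus q)
    (σ := RingHom.id ℂ) (Metric.nhds_basis_ball (x := (0 : ℂ)))).mem_of_mem
    (i := (B, δ)) ⟨hB, hδ⟩
  refine mem_map.2 (mem_of_superset hmem fun f hf => hsU ?_)
  set x := dualPlusEquiv (hp := hp) hS hT hq1 hq hpq f with hx
  obtain ⟨g, hgx, hgP⟩ := exists_dual_eq_seminorm P x
  have hgc : Continuous g := Seminorm.continuous_of_norm_le hP hgP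
  have hyS : (fun n => g (T.eMinus p hp n)) ∈ S.plusSubmodule q :=
    mem_plusSubmodule hS hq1 fun a ha => by
      obtain ⟨M, hM⟩ := weightedBound_of_le_seminorm hT P hP (a := a) (by linarith)
      exact ⟨M, hM g hgP⟩
  let y : S.Plus q := ⟨_, hyS⟩
  -- Both `f y` and `g x` are limits of the same partial sums, as the unit vector expansions
  -- converge in both spaces.
  have h1 : Tendsto (fun N => ∑ n ∈ Finset.range N, y n * x n) atTop (𝓝 (f y)) := by
    refine ((f.continuous.tendsto y).comp (tendsto_sum_ePlus hS hq1 hq y)).congr fun N => ?_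
    simp only [Function.comp_apply, map_sum, map_smul, smul_eq_mul]
    rfl
  have h2 : Tendsto (fun N => ∑ n ∈ Finset.range N, y n * x n) atTop (𝓝 (g x)) := by
    refine ((hgc.tendsto x).comp (tendsto_sum_eMinus hT x)).congr fun N => ?_
    simp only [Function.comp_apply, map_sum, map_smul, smul_eq_mul]
    exact Finset.sum_congr rfl fun n _ => mul_comm _ _
  have h3 := mem_ball_zero_iff.1 (hf y ⟨g, hgP, fun _ => rfl⟩)
  rw [tendsto_nhds_unique h1 h2, hgx, Complex.norm_real,
    Real.norm_of_nonneg (apply_nonneg P x)] at h3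
  exact P.mem_ball_zero.2 h3

end DualPlus

/-! ### The dual of `X(q-)` -/

section DualMinus

variable {hq : 1 < q}

lemma isVonNBounded_minus (hS : S.IsPowerScale 1 c) {a M : ℝ} (ha : c + (q⁻¹).toReal < a)
    {B : Set (S.Minus q hq)} (hB : ∀ x ∈ B, WeightedBound 1 a x M) :
    Bornology.IsVonNBounded ℂ B := by
  intro U hU
  obtain ⟨ε, hε, h⟩ := exists_mem_of_mem_nhds_minus hS ha hU
  refine absorbs_iff_norm.2 ⟨|M| / ε + 1, fun k hk x hx => ?_⟩
  have hk0 : 0 < ‖k‖ := lt_of_lt_of_le (by positivity) hk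
  refine (Set.mem_smul_set_iff_inv_smul_mem₀ (norm_pos_iff.1 hk0) _ _).2
    (h _ _ ((hB x hx).smul k⁻¹) ?_)
  rw [norm_inv, inv_mul_lt_iff₀ hk0]
  calc M ≤ |M| / ε * ε := by rw [div_mul_cancel₀ _ hε.ne']; exact le_abs_self M
    _ < ‖k‖ * ε := by gcongr; linarith

lemma exists_bounds_minus_plus (hS : S.IsPowerScale 1 c) (hT : T.IsPowerScale ∞ c')
    (hp1 : 1 ≤ p) (hp : p < ∞) (hpq : c + (q⁻¹).toReal = -(c' + (p⁻¹).toReal))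
    (x : S.Minus q hq) (y : T.Plus p) :
    ∃ a M M', WeightedBound 1 a x M ∧ WeightedBound ∞ (-a) y M' := by
  obtain ⟨a, ha, M, hM⟩ := hS.exists_bound_minus x
  obtain ⟨M', hM'⟩ := hT.exists_bound_plus hp1 hp (a := -a) (by linarith) y
  exact ⟨a, M, M', hM, hM'⟩

/-- The pairing of `X(q-)` with `Y(p+)`. -/
def pairMinusPlus (hS : S.IsPowerScale 1 c) (hT : T.IsPowerScale ∞ c')
    (hp1 : 1 ≤ p) (hp : p < ∞) (hpq : c + (q⁻¹).toReal = -(c' + (p⁻¹).toReal)) :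
    S.Minus q hq →ₗ[ℂ] T.Plus p →ₗ[ℂ] ℂ :=
  pairing (S.minusCoe q hq) (T.plusCoe p) fun x y => by
    obtain ⟨a, M, M', h, h'⟩ := exists_bounds_minus_plus hS hT hp1 hp hpq x y
    exact (summable_norm_mul h h').of_norm

variable (hS : S.IsPowerScale 1 c) (hT : T.IsPowerScale ∞ c')
    (hp1 : 1 ≤ p) (hp : p < ∞) (hpq : c + (q⁻¹).toReal = -(c' + (p⁻¹).toReal))

lemma norm_pairMinusPlus_le {a M M' : ℝ} {x : S.Minus q hq} {y : T.Plus p}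
    (hx : WeightedBound 1 a x M) (hy : WeightedBound ∞ (-a) y M') :
    ‖pairMinusPlus hS hT hp1 hp hpq x y‖ ≤ M * M' := norm_tsum_mul_le hx hy

lemma continuous_pairMinusPlus_flip (y : T.Plus p) :
    Continuous ((pairMinusPlus (hq := hq) hS hT hp1 hp hpq).flip y) := by
  refine continuous_of_comp_stepToMinus _ fun s => ?_
  obtain ⟨a, h1, h2⟩ := exists_between (add_lt_add_right
    (toReal_inv_lt_toReal_inv (exponent_ne_zero s) s.2) c)
  obtain ⟨C, hC0, hC⟩ := hS.upper s a h2
  obtain ⟨M', hM'⟩ := hT.exists_bound_plus hp1 hp (a := -a) (by linarith) y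
  refine AddMonoidHomClass.continuous_of_bound
    ((pairMinusPlus hS hT hp1 hp hpq).flip y ∘ₗ S.stepToMinusₗ q hq s) (C * M') fun x => ?_
  rw [mul_right_comm]
  exact norm_pairMinusPlus_le hS hT hp1 hp hpq (x := S.stepToMinus q hq s x) (hC x) hM'

lemma continuous_pairMinusPlus (x : S.Minus q hq) :
    Continuous (pairMinusPlus hS hT hp1 hp hpq x) := by
  obtain ⟨a, ha, M, hM⟩ := hS.exists_bound_minus x
  have ha' : -a < c' + (p⁻¹).toReal := by linarith
  exact continuous_of_norm_le_plusToLp hT hp1 hp _ ha' M fun y =>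
    norm_pairMinusPlus_le hS hT hp1 hp hpq hM (weightedBound_norm_plusToLp hT hp1 hp ha' y)

/-- For every subcritical `b`, the exponent `-b` is supercritical for `X(q-)`, so `g` is bounded on
a weighted `ℓ_1`-ball with that exponent. -/
lemma coeff_mem_plusSubmodule (hS : S.IsPowerScale 1 c) (hT : T.IsPowerScale ∞ c')
    (hp1 : 1 ≤ p) (hpq : c + (q⁻¹).toReal = -(c' + (p⁻¹).toReal))
    (g : StrongDual ℂ (S.Minus q hq)) :
    (fun n => g (S.eMinus q hq n)) ∈ T.plusSubmodule p := by
  refine mem_plusSubmodule hT hp1 fun b hb => ?_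
  obtain ⟨ε, hε, h⟩ := exists_mem_of_mem_nhds_minus hS (a := -b) (by linarith)
    (g.continuous.continuousAt.preimage_mem_nhds
      (by rw [map_zero]; exact Metric.ball_mem_nhds _ one_pos))
  have := weightedBound_top_of_functional (S.minusCoe q hq) (S.eMinus q hq) (fun _ => rfl)
    g.toLinearMap hε fun x M hx hM => mem_ball_zero_iff.1 (h x M hx hM)
  exact ⟨_, by rwa [neg_neg] at this⟩

/-- The coefficient map identifies the dual of `X(q-)` with `Y(p+)`. -/
def dualMinusEquiv : StrongDual ℂ (S.Minus q hq) ≃ₗ[ℂ] T.Plus p where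
  toFun g := ⟨fun n => g (S.eMinus q hq n), coeff_mem_plusSubmodule hS hT hp1 hpq g⟩
  map_add' _ _ := rfl
  map_smul' _ _ := rfl
  invFun y := ⟨(pairMinusPlus hS hT hp1 hp hpq).flip y,
    continuous_pairMinusPlus_flip hS hT hp1 hp hpq y⟩
  left_inv g := by
    ext x
    obtain ⟨a, M, M', h, h'⟩ := exists_bounds_minus_plus hS hT hp1 hp hpq x
      ⟨fun n => g (S.eMinus q hq n), coeff_mem_plusSubmodule hS hT hp1 hpq g⟩
    have h1 := (summable_norm_mul h h').of_norm.hasSum.tendsto_sum_nat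
    have h2 := (g.continuous.tendsto x).comp (tendsto_sum_eMinus hS x)
    refine tendsto_nhds_unique h1 (h2.congr fun N => ?_)
    simp only [Function.comp_apply, map_sum, map_smul, smul_eq_mul]
  right_inv y := Subtype.ext (funext fun n => tsum_single_mul y.1 n)

lemma continuous_dualMinusEquiv :
    Continuous (dualMinusEquiv (hq := hq) hS hT hp1 hp hpq) := by
  refine continuous_of_continuousAt_zero (dualMinusEquiv (hq := hq) hS hT hp1 hp hpq) ?_
  rw [ContinuousAt, map_zero]
  intro U hU
  obtain ⟨b, hb, ε, hε, h⟩ := exists_weightedBound_of_mem_nhds hT hp1 hU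
  -- These are the normalized unit vectors of weighted `ℓ_1` with exponent `-b`; the supremum of
  -- `|g|` over them is the weighted `ℓ_∞`-norm of the coefficients of `g`.
  let B : Set (S.Minus q hq) := Set.range fun n => (weight b n : ℂ) • S.eMinus q hq n
  have hB : Bornology.IsVonNBounded ℂ B := by
    refine isVonNBounded_minus hS (a := -b) (M := 1) (by linarith) ?_
    rintro _ ⟨n, rfl⟩
    have := (weightedBound_one_single (-b) n).smul (weight b n : ℂ)
    rwa [Complex.norm_real, Real.norm_of_nonneg (weight_pos _ _).le, weight_mul_neg_self] at this
  have hmem := (ContinuousLinearMap.hasBasis_nhds_zero_of_basis (𝕜₁ := ℂ) (E := S.Minus q hq)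
    (σ := RingHom.id ℂ) (Metric.nhds_basis_ball (x := (0 : ℂ)))).mem_of_mem
    (i := (B, ε / 2)) ⟨hB, half_pos hε⟩
  refine mem_map.2 (mem_of_superset hmem fun g hg => ?_)
  refine h _ (ε / 2) (weightedBound_top.2 fun n => ?_) (by linarith)
  have h1 := mem_ball_zero_iff.1 (hg _ (Set.mem_range_self n))
  rw [map_smul, norm_smul, Complex.norm_real, Real.norm_of_nonneg (weight_pos _ _).le] at h1
  exact h1.le

/-- Banach–Steinhaus: for a bounded set `B` of `X(q-)`, the supremum over `x ∈ B` of the seminorms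
`|⟨x, ·⟩|` is finite at each point of the barrelled space `Y(p+)`, hence continuous. No description
of the bounded sets of the inductive limit is needed. -/
lemma continuous_dualMinusEquiv_symm :
    Continuous (dualMinusEquiv (hq := hq) hS hT hp1 hp hpq).symm := by
  refine continuous_of_continuousAt_zero (dualMinusEquiv (hq := hq) hS hT hp1 hp hpq).symm ?_
  rw [ContinuousAt, map_zero]
  refine (ContinuousLinearMap.hasBasis_nhds_zero_of_basis
    Metric.nhds_basis_ball).tendsto_right_iff.2
    fun ⟨B, δ⟩ ⟨hB, hδ⟩ => ?_
  have := (isFrechet_plus hT hp1 hp).barrelledSpace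
  let P : B → Seminorm ℂ (T.Plus p) := fun x =>
    (pairMinusPlus (hq := hq) hS hT hp1 hp hpq x).toSeminorm
  have hbdd : BddAbove (Set.range P) := Seminorm.bddAbove_range_iff.2 fun y => by
    have h := hB.image (⟨(pairMinusPlus (hq := hq) hS hT hp1 hp hpq).flip y,
      continuous_pairMinusPlus_flip hS hT hp1 hp hpq y⟩ : StrongDual ℂ (S.Minus q hq))
    obtain ⟨M, hM⟩ := (NormedSpace.isVonNBounded_iff' ℂ).1 h
    refine ⟨M, ?_⟩
    rintro _ ⟨x, rfl⟩
    exact hM _ (Set.mem_image_of_mem _ x.2)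
  have hc : Continuous (⨆ x, P x : Seminorm ℂ (T.Plus p)) := by
    rw [Seminorm.coe_iSup_eq hbdd]
    exact Seminorm.continuous_iSup P (fun x =>
      (continuous_pairMinusPlus hS hT hp1 hp hpq x.1).norm) hbdd
  have h0 : (⨆ x, P x) 0 < δ := by rw [map_zero]; exact hδ
  filter_upwards [hc.continuousAt.eventually (Iio_mem_nhds h0)] with y hy x hx
  rw [mem_ball_zero_iff]
  exact lt_of_le_of_lt (le_ciSup hbdd ⟨x, hx⟩ y) hy

end DualMinus

end SequenceScale

/-! ### Conjugate exponents and the final result -/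

lemma neg_one_add_toReal_inv_of_holderConjugate {p p' : ℝ≥0∞} (h : p.HolderConjugate p') :
    -1 + (p'⁻¹).toReal = -(0 + (p⁻¹).toReal) := by
  have h1 : p⁻¹ + p'⁻¹ = 1 := by simpa using h.inv_add_inv_eq_inv
  have h2 := congrArg ENNReal.toReal h1
  have hp : p⁻¹ ≠ ∞ := ne_top_of_le_ne_top ENNReal.one_ne_top (h1 ▸ le_self_add)
  have hp' : p'⁻¹ ≠ ∞ := ne_top_of_le_ne_top ENNReal.one_ne_top (h1 ▸ le_add_self)
  rw [ENNReal.toReal_add hp hp', ENNReal.toReal_one] at h2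
  linarith

lemma one_le_of_holderConjugate {p p' : ℝ≥0∞} (h : p.HolderConjugate p') : 1 ≤ p' := by
  have h1 : p⁻¹ + p'⁻¹ = 1 := by simpa using h.inv_add_inv_eq_inv
  exact ENNReal.inv_le_one.1 (h1 ▸ le_add_self)

lemma lt_top_of_holderConjugate {p p' : ℝ≥0∞} (h : p.HolderConjugate p') (hp : 1 < p) :
    p' < ∞ := by
  have h1 : p⁻¹ + p'⁻¹ = 1 := by simpa using h.inv_add_inv_eq_inv
  refine lt_top_iff_ne_top.2 fun hp' => ?_
  rw [hp', ENNReal.inv_top, add_zero, ENNReal.inv_eq_one] at h1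
  exact hp.ne' h1

end SeqSpace

end

theorem proposition4p3 :
    (∀ (p p' : ℝ≥0∞) (_ : p.HolderConjugate p') (hp : 1 < p),
      (∃ Φ : StrongDual ℂ (ces.Plus p') ≃L[ℂ] d.Minus p hp,
        ∀ (f : StrongDual ℂ (ces.Plus p')) (n : ℕ), Φ f n = f (ces.ePlus p' n)) ∧
      IsDFS (StrongDual ℂ (ces.Plus p')) ∧
      IsDFS (d.Minus p hp) ∧
      ∀ (s : ℕ → Exponent) (hs : ∀ k, s k < p), StrictMono s →
        Tendsto (fun k => (s k : ℝ≥0∞)) atTop (𝓝 p) →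
        (∀ x : d.Minus p hp, ∃ k, (x : ℕ → ℂ) ∈ d.space (s k)) ∧
        (inferInstance : TopologicalSpace (d.Minus p hp)) =
          inductiveLimitTopology (fun k => d.stepToMinus p hp ⟨s k, hs k⟩)) ∧
    (∀ (p p' : ℝ≥0∞) (_ : p.HolderConjugate p') (_ : p < ∞) (hp' : 1 < p'),
      (∃ Ψ : StrongDual ℂ (ces.Minus p' hp') ≃L[ℂ] d.Plus p,
        ∀ (g : StrongDual ℂ (ces.Minus p' hp')) (n : ℕ), Ψ g n = g (ces.eMinus p' hp' n)) ∧
      IsFrechetSchwartz (StrongDual ℂ (ces.Minus p' hp')) ∧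
      IsFrechetSchwartz (d.Plus p)) := by
  refine ⟨fun p p' h hp => ?_, fun p p' h hp hp' => ?_⟩
  · have hq1 := one_le_of_holderConjugate h
    have hq := lt_top_of_holderConjugate h hp
    have hpq := neg_one_add_toReal_inv_of_holderConjugate h
    let Φ : StrongDual ℂ (ces.Plus p') ≃L[ℂ] d.Minus p hp :=
      { SequenceScale.dualPlusEquiv isPowerScale_ces isPowerScale_d hq1 hq hpq with
        continuous_toFun :=
          SequenceScale.continuous_dualPlusEquiv isPowerScale_ces isPowerScale_d hq1 hq hpq
        continuous_invFun :=
          SequenceScale.continuous_dualPlusEquiv_symm isPowerScale_ces isPowerScale_d hq1 hq hpq }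
    have hF : IsFrechetSchwartz (ces.Plus p') :=
      SequenceScale.isFrechetSchwartz_plus isPowerScale_ces hq1 hq
    exact ⟨⟨Φ, fun f n => rfl⟩, ⟨ces.Plus p', _, _, _, hF, ⟨.refl ℂ _⟩⟩,
      ⟨ces.Plus p', _, _, _, hF, ⟨Φ.symm⟩⟩,
      fun s hs _ hlim => SequenceScale.minus_eq_inductiveLimit isPowerScale_d s hs hlim⟩
  · have hp1 := one_le_of_holderConjugate h.symm
    have hpq := neg_one_add_toReal_inv_of_holderConjugate h
    let Ψ : StrongDual ℂ (ces.Minus p' hp') ≃L[ℂ] d.Plus p :=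
      { SequenceScale.dualMinusEquiv isPowerScale_ces isPowerScale_d hp1 hp hpq with
        continuous_toFun :=
          SequenceScale.continuous_dualMinusEquiv isPowerScale_ces isPowerScale_d hp1 hp hpq
        continuous_invFun :=
          SequenceScale.continuous_dualMinusEquiv_symm isPowerScale_ces isPowerScale_d hp1 hp hpq }
    have hF : IsFrechetSchwartz (d.Plus p) :=
      SequenceScale.isFrechetSchwartz_plus isPowerScale_d hp1 hp
    exact ⟨⟨Ψ, fun g n => rfl⟩, hF.of_continuousLinearEquiv Ψ, hF⟩
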